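/- Let $L\ge 6$ be an even integer, let $$G_L=\langle a,x,y,s,t\mid sas^{-1}=x,\ tat^{-1}=y,\ a^L=xy,\ [a,x]=[x,y]=[y,a]=1\rangle,$$ and let $H=\langle a,x,y\rangle\le G_L$. Let $X$ be the Cayley graph of $G_L$ with respect to $\{a,x,y,s,t\}$, regarded as a metric graph with its path metric, in which $a$-, $s$- and $t$-edges have length $1$ and $x$- and $y$-edges have length $L$. Regard $H$ as the subgraph of $X$ formed by the vertices in $H$ and the $a$-, $x$- and $y$-edges between them. Paths in $X$ are edge paths between vertices, parameterized by arclength, and $|\gamma|$ denotes the length of $\gamma$; a path is $K$-biLipschitz if $\frac1K|p-q|\le d_X(\gamma(p),\gamma(q))\le K|p-q|$ for all parameters $p,q$. The endpoints $g,h$ of a path differ by $g^{-1}h$. An escape (from $H$) is a nontrivial path that meets $H$ precisely at its endpoints; it is an $a$-, $x$- or $y$-escape if its endpoints differ by a power of $a$, $x$ or $y$, respectively. For every real $R'>1$ there exist $J'>1$, $1<K<2$ and $c>0$ (depending only on $L$ and $R'$) such that the following holds for every $K$-biLipschitz path $\gamma$ in $X$ with endpoints in $H$. Call a subpath of $\gamma$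 a long escape of $\gamma$ if it is an escape from $H$ of length at least $c\,|\gamma|$. Then either $|\gamma|\le J'$, or all of the following hold. 1. The path $\gamma$ has exactly one or exactly two long escapes, and the sum of their lengths is at least $\frac{R'-1}{R'}|\gamma|$. 2. If there are two long escapes, then one is an $x$-escape and the other is a $y$-escape. 3. If the endpoints of $\gamma$ differ by a power of $x$ (respectively, of $y$), then there is exactly one long escape, and it is an $x$-escape (respectively, a $y$-escape). 4. If the endpoints of $\gamma$ differ by a power of $a$, then either there is exactly one long escape and it is an $a$-escape, or there are exactly two long escapes, one an $x$-escape and the other a $y$-escape. -/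

import Mathlib

namespace Snowflake

/-- The generators `a, x, y, s, t`. -/
inductive Gen
  | a
  | x
  | y
  | s
  | t

/-- The generators `a, x, y` of the vertex group. -/
def Gen.IsToral : Gen → Prop
  | .a => True
  | .x => True
  | .y => True
  | .s => False
  | .t => False

/-- Lengths of the edges of the Cayley graph: `x` and `y` edges have length `L`, the others
have length `1`. -/
def Gen.len (L : ℕ) : Gen → ℕ
  | .a => 1
  | .x => L
  | .y => L
  | .s => 1
  | .t => 1

/-- The relators of
`⟨a, x, y, s, t ∣ s a s⁻¹ = x, t a t⁻¹ = y, a ^ L = x y, [a,x] = [x,y] = [y,a] = 1⟩`. -/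
def relators (L : ℕ) : Set (FreeGroup Gen) :=
  {FreeGroup.of Gen.s * FreeGroup.of Gen.a * (FreeGroup.of Gen.s)⁻¹ * (FreeGroup.of Gen.x)⁻¹,
   FreeGroup.of Gen.t * FreeGroup.of Gen.a * (FreeGroup.of Gen.t)⁻¹ * (FreeGroup.of Gen.y)⁻¹,
   FreeGroup.of Gen.a ^ L * (FreeGroup.of Gen.x * FreeGroup.of Gen.y)⁻¹,
   FreeGroup.of Gen.a * FreeGroup.of Gen.x * (FreeGroup.of Gen.a)⁻¹ * (FreeGroup.of Gen.x)⁻¹,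
   FreeGroup.of Gen.x * FreeGroup.of Gen.y * (FreeGroup.of Gen.x)⁻¹ * (FreeGroup.of Gen.y)⁻¹,
   FreeGroup.of Gen.y * FreeGroup.of Gen.a * (FreeGroup.of Gen.y)⁻¹ * (FreeGroup.of Gen.a)⁻¹}

/-- The snowflake group `G_L`. -/
abbrev G (L : ℕ) : Type := PresentedGroup (relators L)

/-- A generator as an element of `G_L`. -/
def gen (L : ℕ) (e : Gen) : G L := PresentedGroup.of e

/-- The vertex group `H = ⟨a, x, y⟩`. -/
def H (L : ℕ) : Subgroup (G L) := Subgroup.closure {gen L .a, gen L .x, gen L .y}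

/-- A letter: a generator (`true`) or its inverse (`false`), as in `FreeGroup`. -/
abbrev Letter : Type := Gen × Bool

/-- The element of `G_L` represented by a letter. -/
def letterVal (L : ℕ) (l : Letter) : G L := if l.2 then gen L l.1 else (gen L l.1)⁻¹

/-- The element of `G_L` represented by a word. -/
def wordVal (L : ℕ) (w : List Letter) : G L := (w.map (letterVal L)).prod

/-- The length of a word: the sum of the lengths of the edges it crosses. -/
def wordLen (L : ℕ) (w : List Letter) : ℕ := (w.map fun l => l.1.len L).sum

/-- `|g|`: the least length of a word representing `g`. -/
noncomputable def norm (L : ℕ) (g : G L) : ℕ :=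
  sInf {n : ℕ | ∃ w : List Letter, wordVal L w = g ∧ wordLen L w = n}

/-- The distance in `X_L` between two vertices. -/
noncomputable def vertexDist (L : ℕ) (g h : G L) : ℝ := (norm L (g⁻¹ * h) : ℝ)

/-- A point of the metric graph `X_L`: the point at distance `offset` from `base` on the
edge from `base` to `base * label`. (A vertex is represented once for each incident edge; these
representatives are at distance `0` from each other.) -/
structure Point (L : ℕ) where
  base : G L
  label : Gen
  offset : ℝ
  offset_nonneg : 0 ≤ offset
  offset_le : offset ≤ label.len L

/-- The length of a shortest path in `X_L` between `p` and `q` that goes through one of the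
ends of the edge of `p` and one of the ends of the edge of `q`. -/
noncomputable def distThroughEnds (L : ℕ) (p q : Point L) : ℝ :=
  min
    (min
      (p.offset + vertexDist L p.base q.base + q.offset)
      (p.offset + vertexDist L p.base (q.base * gen L q.label) + (q.label.len L - q.offset)))
    (min
      ((p.label.len L - p.offset) + vertexDist L (p.base * gen L p.label) q.base + q.offset)
      ((p.label.len L - p.offset) +
        vertexDist L (p.base * gen L p.label) (q.base * gen L q.label) +
        (q.label.len L - q.offset)))

open Classical in
/-- The path metric of the metric graph `X_L`. -/
noncomputable def pointDist (L : ℕ) (p q : Point L) : ℝ :=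
  if p.base = q.base ∧ p.label = q.label then
    min |p.offset - q.offset| (distThroughEnds L p q)
  else distThroughEnds L p q

/-- An edge path in `X_L`: its initial vertex and the word read along it. -/
structure EdgePath (L : ℕ) where
  start : G L
  word : List Letter

namespace EdgePath

variable {L : ℕ}

/-- The vertex of the path after its first `i` edges. -/
def vertex (γ : EdgePath L) (i : ℕ) : G L := γ.start * wordVal L (γ.word.take i)

/-- The terminal vertex. -/
def finish (γ : EdgePath L) : G L := γ.vertex γ.word.length

/-- The length of the path in `X_L`. -/
def len (γ : EdgePath L) : ℕ := wordLen L γ.word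

/-- The length of the `i`-th edge. -/
def edgeLen (γ : EdgePath L) (i : Fin γ.word.length) : ℕ := (γ.word.get i).1.len L

/-- The arclength parameter of the point at distance `u` along the `i`-th edge. -/
def param (γ : EdgePath L) (i : Fin γ.word.length) (u : ℝ) : ℝ :=
  (wordLen L (γ.word.take i) : ℝ) + u

/-- The point of `X_L` at distance `u` along the `i`-th edge of the path. -/
def point (γ : EdgePath L) (i : Fin γ.word.length) (u : Set.Icc (0 : ℝ) (γ.edgeLen i)) :
    Point L :=
  if (γ.word.get i).2 then
    { base := γ.vertex i
      label := (γ.word.get i).1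
      offset := u
      offset_nonneg := u.2.1
      offset_le := u.2.2 }
  else
    { base := γ.vertex (i + 1)
      label := (γ.word.get i).1
      offset := γ.edgeLen i - u
      offset_nonneg := sub_nonneg.2 u.2.2
      offset_le := sub_le_self _ u.2.1 }

/-- The path, parametrized by arclength, is a `K`-biLipschitz map to the metric graph `X_L`. -/
def IsBiLipschitz (K : ℝ) (γ : EdgePath L) : Prop :=
  ∀ (i j : Fin γ.word.length) (u : Set.Icc (0 : ℝ) (γ.edgeLen i))
    (v : Set.Icc (0 : ℝ) (γ.edgeLen j)),
    K⁻¹ * |γ.param i u - γ.param j v| ≤ pointDist L (γ.point i u) (γ.point j v) ∧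
      pointDist L (γ.point i u) (γ.point j v) ≤ K * |γ.param i u - γ.param j v|

/-- The endpoints of the path differ by a power of the generator `e`. -/
def DiffersByPowerOf (γ : EdgePath L) (e : Gen) : Prop :=
  γ.start⁻¹ * γ.finish ∈ Subgroup.zpowers (gen L e)

/-- The path is an escape from `H`: it is nontrivial and meets `H` (the subgraph of `X_L` formed
by the vertices in `H` and the `a`, `x` and `y` edges between them) precisely at its
endpoints. -/
structure IsEscape (γ : EdgePath L) : Prop where
  nontrivial : γ.word ≠ []
  start_mem : γ.start ∈ H L
  finish_mem : γ.finish ∈ H L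
  vertex_notMem : ∀ i, 0 < i → i < γ.word.length → γ.vertex i ∉ H L
  edge_notMem : ∀ i : Fin γ.word.length,
    ¬ (γ.vertex i ∈ H L ∧ (γ.word.get i).1.IsToral)

/-- The path is an `e`-escape from `H`, for `e` one of `a`, `x`, `y`. -/
def IsEscapeOfFlavor (γ : EdgePath L) (e : Gen) : Prop :=
  γ.IsEscape ∧ γ.DiffersByPowerOf e

/-- The subpath of `γ` from its `p.1`-st to its `p.2`-nd vertex. -/
def subpath (γ : EdgePath L) (p : ℕ × ℕ) : EdgePath L where
  start := γ.vertex p.1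
  word := (γ.word.take p.2).drop p.1

/-- The subpaths of `γ` that are escapes from `H` and have length at least `c * |γ|`. A subpath
is given by the positions of its endpoints, so that the same word occurring at two places of `γ`
counts twice. -/
def longEscapes (γ : EdgePath L) (c : ℝ) : Set (ℕ × ℕ) :=
  {p | p.1 < p.2 ∧ p.2 ≤ γ.word.length ∧ (γ.subpath p).IsEscape ∧
    c * γ.len ≤ (γ.subpath p).len}

/-- `γ` has exactly one long escape. -/
def HasOneLongEscape (γ : EdgePath L) (c : ℝ) (ε : ℕ × ℕ) : Prop :=
  γ.longEscapes c = {ε}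

/-- `γ` has exactly two long escapes, of which `ε₀` is an `x`-escape and `ε₁` a `y`-escape. -/
def HasTwoLongEscapes (γ : EdgePath L) (c : ℝ) (ε₀ ε₁ : ℕ × ℕ) : Prop :=
  γ.longEscapes c = {ε₀, ε₁} ∧ ε₀ ≠ ε₁ ∧
    (γ.subpath ε₀).IsEscapeOfFlavor .x ∧ (γ.subpath ε₁).IsEscapeOfFlavor .y

end EdgePath

end Snowflake

/-!
A word `w` read along a path with endpoints in `H` is cut into pieces: edges in `H` and escapes.
`G_L` acts on a tree in which every edge separates, so an escape returns through the edge by which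
it left, and its value is a power of `a`, `x` or `y`, called its flavor. Separation is
obtained without normal forms: counting signed crossings of an edge is a function on `G_L`, because
the count respects the relators (`exists_crossing`, `IsEscapeWord.eq_conj`). The action of `G_L` on
`ℤ × ℤ` by affine maps shows that `H` is free abelian of rank two (`toral_inj`).

Write `‖n‖` for the norm of `a ^ n`; this is also the norm of `x ^ n` and `y ^ n` up to an error
of at most `2`. As the pieces commute in `H`, comparing a geodesic for `a ^ n` with its pieces
gives the recursion `‖n‖ = |i| + 2 * ‖m‖ + 4` for some `m` and `i` with `n = i + L * m` and
`|i| ≤ 2 * L`, except for bounded `n` (`aNorm_recursion`). So a geodesic for `a ^ n` is an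
expansion of `n` in base `L`, and the conjugating letters make up at least a fixed proportion of
its length. Adding two expansions digit by digit saves the conjugating letters of the shorter one,
so the norm is strictly subadditive:
`‖n + m‖ ≤ ‖n‖ + ‖m‖ - min ‖n‖ ‖m‖ / (L + 1) + 4` (`aNorm_add_strict`).

The biLipschitz condition enters only through the whole path: its length exceeds the distance of
its endpoints by at most `(K - 1) * |γ|`. Collecting the pieces of each flavor and replacing them
by geodesics, strict subadditivity shows that up to a small proportion of `|γ|` each flavor
consists of a single escape (`exists_dominant_escape`), and that the flavor `a` is not present
together with `x` or `y`, since `a ^ i` could be rewritten in terms of `x` and `y` and combined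
with them (`exists_toral_of_nearGeodesic`). If the endpoints differ by a power of `x`, the total
exponents `i` of `a` and `k` of `y` satisfy `i = - L * k`, so that their contributions are
comparable and hence both small; for a power of `a`, the total exponents of `x` and `y` are equal,
so that both or neither of these flavors are present.
-/

namespace Snowflake

variable {L : ℕ}

/-! ### Words -/

@[simp] lemma wordVal_nil : wordVal L [] = 1 := rfl

@[simp] lemma wordVal_cons (l : Letter) (w : List Letter) :
    wordVal L (l :: w) = letterVal L l * wordVal L w := by simp [wordVal]

@[simp] lemma wordVal_append (v w : List Letter) :
    wordVal L (v ++ w) = wordVal L v * wordVal L w := by simp [wordVal]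

@[simp] lemma wordLen_nil : wordLen L [] = 0 := rfl

@[simp] lemma wordLen_cons (l : Letter) (w : List Letter) :
    wordLen L (l :: w) = l.1.len L + wordLen L w := by simp [wordLen]

@[simp] lemma wordLen_append (v w : List Letter) :
    wordLen L (v ++ w) = wordLen L v + wordLen L w := by simp [wordLen]

lemma letterVal_not (e : Gen) (b : Bool) :
    letterVal L (e, !b) = (letterVal L (e, b))⁻¹ := by
  cases b <;> simp [letterVal]

lemma wordVal_invRev (w : List Letter) : wordVal L (FreeGroup.invRev w) = (wordVal L w)⁻¹ := by
  induction w with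
  | nil => simp
  | cons l w ih =>
    have : FreeGroup.invRev (l :: w) = FreeGroup.invRev w ++ [(l.1, !l.2)] := by
      simp [FreeGroup.invRev]
    rw [this, wordVal_append, ih, wordVal_cons, wordVal_nil, mul_one, letterVal_not,
      wordVal_cons, mul_inv_rev]

lemma wordLen_invRev (w : List Letter) : wordLen L (FreeGroup.invRev w) = wordLen L w := by
  induction w with
  | nil => simp
  | cons l w ih =>
    have : FreeGroup.invRev (l :: w) = FreeGroup.invRev w ++ [(l.1, !l.2)] := by
      simp [FreeGroup.invRev]
    rw [this, wordLen_append, ih, wordLen_cons, wordLen_nil, wordLen_cons]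
    simp [add_comm]

lemma exists_wordVal_eq (g : G L) : ∃ w, wordVal L w = g := by
  have hg : g ∈ Subgroup.closure (Set.range (PresentedGroup.of (rels := relators L))) := by
    simp [PresentedGroup.closure_range_of]
  induction hg using Subgroup.closure_induction with
  | mem g hg => obtain ⟨e, rfl⟩ := hg; exact ⟨[(e, true)], by simp [letterVal, gen]⟩
  | one => exact ⟨[], rfl⟩
  | mul g h _ _ hg hh =>
    obtain ⟨v, rfl⟩ := hg
    obtain ⟨w, rfl⟩ := hh
    exact ⟨v ++ w, wordVal_append v w⟩
  | inv g _ hg =>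
    obtain ⟨v, rfl⟩ := hg
    exact ⟨FreeGroup.invRev v, wordVal_invRev v⟩

/-! ### The norm -/

lemma norm_wordVal_le (w : List Letter) : norm L (wordVal L w) ≤ wordLen L w :=
  Nat.sInf_le ⟨w, rfl, rfl⟩

lemma exists_geodesic (g : G L) : ∃ w, wordVal L w = g ∧ wordLen L w = norm L g := by
  obtain ⟨w, hw⟩ := exists_wordVal_eq g
  exact Nat.sInf_mem (s := {n : ℕ | ∃ w : List Letter, wordVal L w = g ∧ wordLen L w = n})
    ⟨_, w, hw, rfl⟩

lemma norm_one : norm L 1 = 0 := Nat.le_zero.1 (norm_wordVal_le (L := L) [])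

lemma norm_mul_le (g h : G L) : norm L (g * h) ≤ norm L g + norm L h := by
  obtain ⟨v, rfl, hv⟩ := exists_geodesic g
  obtain ⟨w, rfl, hw⟩ := exists_geodesic h
  rw [← hv, ← hw, ← wordVal_append, ← wordLen_append]
  exact norm_wordVal_le _

lemma norm_inv (g : G L) : norm L g⁻¹ = norm L g := by
  have key : ∀ h : G L, norm L h⁻¹ ≤ norm L h := fun h => by
    obtain ⟨v, rfl, hv⟩ := exists_geodesic h
    rw [← hv, ← wordVal_invRev, ← wordLen_invRev]
    exact norm_wordVal_le _
  exact le_antisymm (key g) (by simpa using key g⁻¹)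

lemma norm_gen_le (e : Gen) : norm L (gen L e) ≤ e.len L := by
  simpa [letterVal] using norm_wordVal_le (L := L) [(e, true)]

lemma norm_zpow_le (g : G L) (n : ℤ) : norm L (g ^ n) ≤ n.natAbs * norm L g := by
  have key : ∀ k : ℕ, norm L (g ^ k) ≤ k * norm L g := fun k => by
    induction k with
    | zero => simp [norm_one]
    | succ k ih =>
      rw [pow_succ, Nat.succ_mul]
      exact (norm_mul_le _ _).trans (Nat.add_le_add_right ih _)
  rcases Int.natAbs_eq n with h | h
  · rw [h, zpow_natCast, Int.natAbs_natCast]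
    exact key _
  · rw [h, zpow_neg, norm_inv, zpow_natCast, Int.natAbs_neg, Int.natAbs_natCast]
    exact key _

/-! ### Relations and the vertex group -/

lemma mk_eq_one_of_mem {r : FreeGroup Gen} (hr : r ∈ relators L) :
    (PresentedGroup.mk (relators L) r) = 1 := PresentedGroup.one_of_mem hr

lemma s_mul_a : gen L .s * gen L .a = gen L .x * gen L .s := by
  have h := mk_eq_one_of_mem (L := L) (Or.inl rfl)
  simp only [map_mul, map_inv] at h
  exact mul_inv_eq_iff_eq_mul.1 (mul_inv_eq_one.1 h)

lemma t_mul_a : gen L .t * gen L .a = gen L .y * gen L .t := by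
  have h := mk_eq_one_of_mem (L := L) (Or.inr (Or.inl rfl))
  simp only [map_mul, map_inv] at h
  exact mul_inv_eq_iff_eq_mul.1 (mul_inv_eq_one.1 h)

lemma a_pow : gen L .a ^ L = gen L .x * gen L .y := by
  have h := mk_eq_one_of_mem (L := L) (Or.inr (Or.inr (Or.inl rfl)))
  simp only [map_mul, map_inv, map_pow] at h
  exact mul_inv_eq_one.1 h

lemma commute_a_x : Commute (gen L .a) (gen L .x) := by
  have h := mk_eq_one_of_mem (L := L) (Or.inr (Or.inr (Or.inr (Or.inl rfl))))
  simp only [map_mul, map_inv] at h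
  exact mul_inv_eq_iff_eq_mul.1 (mul_inv_eq_one.1 h)

lemma commute_x_y : Commute (gen L .x) (gen L .y) := by
  have h := mk_eq_one_of_mem (L := L) (Or.inr (Or.inr (Or.inr (Or.inr (Or.inl rfl)))))
  simp only [map_mul, map_inv] at h
  exact mul_inv_eq_iff_eq_mul.1 (mul_inv_eq_one.1 h)

lemma commute_y_a : Commute (gen L .y) (gen L .a) := by
  have h := mk_eq_one_of_mem (L := L) (Or.inr (Or.inr (Or.inr (Or.inr (Or.inr rfl)))))
  simp only [map_mul, map_inv] at h
  exact mul_inv_eq_iff_eq_mul.1 (mul_inv_eq_one.1 h)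

/-- The element `a ^ i * x ^ j * y ^ k` of the vertex group. -/
def toral (L : ℕ) (i j k : ℤ) : G L := gen L .a ^ i * gen L .x ^ j * gen L .y ^ k

lemma toral_mul (i j k i' j' k' : ℤ) :
    toral L i j k * toral L i' j' k' = toral L (i + i') (j + j') (k + k') := by
  have h1 : gen L .y ^ k * gen L .a ^ i' = gen L .a ^ i' * gen L .y ^ k :=
    (commute_y_a.zpow_zpow k i')
  have h2 : gen L .x ^ j * gen L .a ^ i' = gen L .a ^ i' * gen L .x ^ j :=
    (commute_a_x.symm.zpow_zpow j i')
  have h3 : gen L .y ^ k * gen L .x ^ j' = gen L .x ^ j' * gen L .y ^ k :=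
    (commute_x_y.symm.zpow_zpow k j')
  simp only [toral, zpow_add]
  calc _ = gen L .a ^ i * gen L .x ^ j * (gen L .y ^ k * gen L .a ^ i') * gen L .x ^ j'
          * gen L .y ^ k' := by group
    _ = gen L .a ^ i * (gen L .x ^ j * gen L .a ^ i') * (gen L .y ^ k * gen L .x ^ j')
          * gen L .y ^ k' := by rw [h1]; group
    _ = _ := by rw [h2, h3]; group

lemma toral_a (n : ℤ) : toral L n 0 0 = gen L .a ^ n := by simp [toral]
lemma toral_x (n : ℤ) : toral L 0 n 0 = gen L .x ^ n := by simp [toral]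
lemma toral_y (n : ℤ) : toral L 0 0 n = gen L .y ^ n := by simp [toral]

lemma toral_eq (i j k m : ℤ) : toral L (i + L * m) j k = toral L i (j + m) (k + m) := by
  have h : gen L .a ^ ((L : ℤ) * m) = gen L .x ^ m * gen L .y ^ m := by
    rw [zpow_mul, zpow_natCast, a_pow, commute_x_y.mul_zpow]
  have h' : toral L (L * m) 0 0 = toral L 0 m m := by
    simp [toral, h]
  have h1 := toral_mul (L := L) i j k (L * m) 0 0
  have h2 := toral_mul (L := L) i j k 0 m m
  rw [h', h2] at h1
  simpa using h1.symm

/-- The action of the generators on `ℤ × ℤ` by integral affine maps: `a`, `x`, `y` are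
translations by the primitive vectors `(1, 0)`, `(0, 1)`, `(L, -1)`, and `s`, `t` are linear maps
taking the first of these vectors to the second and to the third. -/
def affine (L : ℕ) : Gen → Equiv.Perm (ℤ × ℤ)
  | .a => Equiv.addRight (1, 0)
  | .x => Equiv.addRight (0, 1)
  | .y => Equiv.addRight ((L : ℤ), -1)
  | .s => Equiv.prodComm ℤ ℤ
  | .t =>
    { toFun := fun p => (L * p.1 + p.2, -p.1)
      invFun := fun p => (-p.2, p.1 + L * p.2)
      left_inv := fun p => by ext <;> simp
      right_inv := fun p => by ext <;> simp }

lemma addRight_zpow {V : Type*} [AddCommGroup V] (v : V) (n : ℤ) :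
    (Equiv.addRight v : Equiv.Perm V) ^ n = Equiv.addRight (n • v) := by
  have key : ∀ k : ℕ, (Equiv.addRight v : Equiv.Perm V) ^ k = Equiv.addRight (k • v) := fun k => by
    induction k with
    | zero => ext; simp
    | succ k ih => ext p; simp [pow_succ, ih, succ_nsmul', add_assoc]
  cases n with
  | ofNat k => simp [key k]
  | negSucc k => rw [zpow_negSucc, key, negSucc_zsmul]; ext p; simp [Equiv.Perm.inv_def]

lemma affine_relators : ∀ r ∈ relators L, FreeGroup.lift (affine L) r = 1 := by
  rintro r (rfl | rfl | rfl | rfl | rfl | rfl) <;>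
    simp only [map_mul, map_inv, map_pow, FreeGroup.lift_apply_of,
      mul_inv_eq_iff_eq_mul, one_mul]
  · ext p <;> simp [affine]
  · ext p <;> simp [affine]
    all_goals ring
  · rw [← zpow_natCast]
    simp only [affine, addRight_zpow]
    ext p <;> simp
  · ext p <;> simp [affine]
  · ext p <;> simp [affine]
  · ext p <;> simp [affine]
    ring

/-- The action of `G_L` on `ℤ × ℤ` given by `affine`. It is faithful on the vertex group. -/
def affineHom (L : ℕ) : G L →* Equiv.Perm (ℤ × ℤ) := PresentedGroup.toGroup affine_relators

lemma affineHom_toral (i j k : ℤ) : affineHom L (toral L i j k) 0 = (i + L * k, j - k) := by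
  have h : ∀ e, affineHom L (gen L e) = affine L e := fun e => PresentedGroup.toGroup.of _
  simp only [toral, map_mul, map_zpow, h, affine, addRight_zpow, Equiv.Perm.mul_apply]
  ext <;> simp <;> ring

/-- The vertex group is free abelian of rank two: the only relation between the exponents is
`a ^ L = x * y`. -/
lemma toral_inj {i j k i' j' k' : ℤ} (h : toral L i j k = toral L i' j' k') :
    i + L * k = i' + L * k' ∧ j - k = j' - k' := by
  have h' := congrArg (fun g => affineHom L g 0) h
  simpa [affineHom_toral, Prod.ext_iff] using h'

lemma gen_mem_H {e : Gen} (he : e.IsToral) : gen L e ∈ H L := by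
  apply Subgroup.subset_closure
  cases e <;> simp_all [Gen.IsToral]

lemma letterVal_mem_H {l : Letter} (hl : l.1.IsToral) : letterVal L l ∈ H L := by
  unfold letterVal
  split
  · exact gen_mem_H hl
  · exact inv_mem (gen_mem_H hl)

/-! ### Escapes return through the edge by which they left -/

/-- Every edge of the Bass-Serre tree separates it. Algebraically: for a stable letter `e`, with
`e * a = c * e`, and a set `S` of vertices that is invariant under right multiplication by `c`,
the signed number of `e`-edges issuing from `S` crossed by a path from `1` depends only on the
endpoint of the path. -/
lemma exists_crossing (e c : Gen) (hec : e = .s ∧ c = .x ∨ e = .t ∧ c = .y) (S : Set (G L))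
    (hS : ∀ g, g * gen L c ∈ S ↔ g ∈ S) :
    ∃ F : G L → ℤ, F 1 = 0 ∧ (∀ h ∈ H L, ∀ g, F (g * h) = F g) ∧
      (∀ g d, (d = e → g ∉ S) → F (g * gen L d) = F g) ∧
      ∀ g ∈ S, F (g * gen L e) = F g + 1 := by
  classical
  -- `step d` moves along the edge labelled `d` and updates the count
  let step : Gen → Equiv.Perm (G L × ℤ) := fun d =>
    { toFun := fun p => (p.1 * gen L d, p.2 + if d = e ∧ p.1 ∈ S then 1 else 0)
      invFun := fun p => (p.1 * (gen L d)⁻¹,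
        p.2 - if d = e ∧ p.1 * (gen L d)⁻¹ ∈ S then 1 else 0)
      left_inv := fun p => by ext <;> simp
      right_inv := fun p => by ext <;> simp }
  have hstep : ∀ d g n, step d (g, n) = (g * gen L d, n + if d = e ∧ g ∈ S then 1 else 0) :=
    fun d g n => rfl
  have ha : ∀ k : ℕ, ∀ p, (step .a ^ k) p = (p.1 * gen L .a ^ k, p.2) := by
    have hae : Gen.a ≠ e := by rcases hec with ⟨rfl, -⟩ | ⟨rfl, -⟩ <;> simp
    intro k
    induction k with
    | zero => simp
    | succ k ih =>
      intro p
      rw [pow_succ', Equiv.Perm.mul_apply, ih]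
      simp [hstep, hae, pow_succ, mul_assoc]
  have hrel : ∀ r ∈ relators L, FreeGroup.lift (fun d => MulOpposite.op (step d)) r = 1 := by
    have hs := s_mul_a (L := L)
    have ht := t_mul_a (L := L)
    have hax := (commute_a_x (L := L)).eq
    have hxy := (commute_x_y (L := L)).eq
    have hya := (commute_y_a (L := L)).eq
    rintro r (rfl | rfl | rfl | rfl | rfl | rfl) <;>
      simp only [map_mul, map_inv, map_pow, FreeGroup.lift_apply_of, mul_inv_eq_iff_eq_mul,
        one_mul, ← MulOpposite.op_mul, ← MulOpposite.op_pow, MulOpposite.op_inj] <;>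
      refine Equiv.ext fun p => ?_
    · rcases hec with ⟨rfl, rfl⟩ | ⟨rfl, rfl⟩ <;> simp [hstep, hS, hs, mul_assoc]
    · rcases hec with ⟨rfl, rfl⟩ | ⟨rfl, rfl⟩ <;> simp [hstep, hS, ht, mul_assoc]
    · rw [ha, a_pow]
      rcases hec with ⟨rfl, rfl⟩ | ⟨rfl, rfl⟩ <;> simp [hstep, mul_assoc]
    · rcases hec with ⟨rfl, rfl⟩ | ⟨rfl, rfl⟩ <;> simp [hstep, hax, mul_assoc]
    · rcases hec with ⟨rfl, rfl⟩ | ⟨rfl, rfl⟩ <;> simp [hstep, hxy, mul_assoc]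
    · rcases hec with ⟨rfl, rfl⟩ | ⟨rfl, rfl⟩ <;> simp [hstep, hya, mul_assoc]
  let ρ : G L →* (Equiv.Perm (G L × ℤ))ᵐᵒᵖ := PresentedGroup.toGroup hrel
  let σ : G L → Equiv.Perm (G L × ℤ) := fun g => (ρ g).unop
  have hone : σ 1 = 1 := by simp [σ]
  have hmul : ∀ g h p, σ (g * h) p = σ h (σ g p) := fun g h p => by simp [σ]
  have hgen : ∀ d, σ (gen L d) = step d := fun d =>
    congrArg MulOpposite.unop (PresentedGroup.toGroup.of hrel)
  have hfst : ∀ g p, (σ g p).1 = p.1 * g := fun g => by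
    have hg : g ∈ Subgroup.closure (Set.range (PresentedGroup.of (rels := relators L))) := by
      simp [PresentedGroup.closure_range_of]
    induction hg using Subgroup.closure_induction with
    | mem g hg =>
      obtain ⟨d, rfl⟩ := hg
      intro p
      exact congrArg Prod.fst (congrArg (fun f => f p) (hgen d))
    | one => simp [hone]
    | mul g h _ _ hg hh => intro p; rw [hmul, hh, hg, mul_assoc]
    | inv g _ hg =>
      intro p
      have h := hg (σ g⁻¹ p)
      rw [← hmul, inv_mul_cancel, hone, Equiv.Perm.one_apply] at h
      exact eq_mul_inv_of_mul_eq h.symm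
  have hF : ∀ g d, (σ (g * gen L d) (1, 0)).2 =
      (σ g (1, 0)).2 + if d = e ∧ g ∈ S then 1 else 0 := fun g d => by
    rw [hmul, hgen, ← Prod.mk.eta (p := σ g (1, 0)), hstep, hfst, one_mul]
  refine ⟨fun g => (σ g (1, 0)).2, by simp [hone], fun h hh => ?_, fun g d hd => ?_,
    fun g hg => ?_⟩
  · have key : ∀ d : Gen, d.IsToral → ∀ g, (σ (g * gen L d) (1, 0)).2 = (σ g (1, 0)).2 := by
      intro d hd g
      have : d ≠ e := by rcases hec with ⟨rfl, -⟩ | ⟨rfl, -⟩ <;> rintro rfl <;> exact hd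
      rw [hF]; simp [this]
    induction hh using Subgroup.closure_induction with
    | mem h hh =>
      rcases hh with rfl | rfl | rfl
      exacts [key .a trivial, key .x trivial, key .y trivial]
    | one => simp
    | mul h h' _ _ ih ih' => intro g; rw [← mul_assoc, ih', ih]
    | inv h _ ih => intro g; simpa using (ih (g * h⁻¹)).symm
  · beta_reduce; rw [hF, if_neg (fun h => hd h.1 h.2), add_zero]
  · beta_reduce; rw [hF, if_pos ⟨rfl, hg⟩]

/-- The generator of `H` in whose cyclic subgroup an escape starting with the given letter has
its value. Letters of `H` are assigned their own generator. -/
def flavor : Letter → Gen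
  | (.a, _) => .a
  | (.x, _) => .x
  | (.y, _) => .y
  | (.s, true) => .x
  | (.s, false) => .a
  | (.t, true) => .y
  | (.t, false) => .a

/-- For a stable letter `e`, the generator such that conjugation by `e` takes its powers to the
powers of `flavor e`. -/
def innerGen : Letter → Gen
  | (.s, false) => .x
  | (.t, false) => .y
  | _ => .a

lemma flavor_isToral (l : Letter) : (flavor l).IsToral := by
  rcases l with ⟨_ | _ | _ | _ | _, _ | _⟩ <;> trivial

lemma conj_innerGen {e : Gen} (he : ¬ e.IsToral) (b : Bool) (n : ℤ) :
    letterVal L (e, b) * gen L (innerGen (e, b)) ^ n * letterVal L (e, !b) =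
      gen L (flavor (e, b)) ^ n := by
  have key : ∀ g a c : G L, g * a = c * g → g * a ^ n * g⁻¹ = c ^ n ∧ g⁻¹ * c ^ n * g = a ^ n := by
    intro g a c h
    have h' : c = g * a * g⁻¹ := by rw [h]; group
    subst h'
    rw [conj_zpow]
    exact ⟨rfl, by group⟩
  have hs := key _ _ _ (s_mul_a (L := L))
  have ht := key _ _ _ (t_mul_a (L := L))
  cases e <;> cases b <;> simp_all [Gen.IsToral, letterVal, flavor, innerGen]

/-- A function on the group that vanishes on `H`, becomes positive when a path leaves `H` through
the letter `(e, b)`, and can only decrease when the path returns through the same edge of the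
Bass-Serre tree. -/
lemma exists_height {e : Gen} (he : ¬ e.IsToral) (b : Bool) :
    ∃ F : G L → ℤ, (∀ h ∈ H L, F h = 0) ∧ 0 < F (letterVal L (e, b)) ∧
      ∀ g l, F (g * letterVal L l) < F g → l = (e, !b) ∧
        g * letterVal L l ∈ Subgroup.zpowers (gen L (flavor (e, b))) := by
  obtain ⟨c, hec, hc⟩ : ∃ c, (e = .s ∧ c = .x ∨ e = .t ∧ c = .y) ∧
      gen L e * gen L .a = gen L c * gen L e := by
    cases e <;> simp_all [Gen.IsToral, s_mul_a, t_mul_a]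
  have htoral : ∀ (F : G L → ℤ), (∀ h ∈ H L, ∀ g, F (g * h) = F g) →
      ∀ l : Letter, l.1.IsToral → ∀ g, F (g * letterVal L l) = F g := fun F hF l hl g =>
    hF _ (letterVal_mem_H hl) g
  have hfl : flavor (e, true) = c ∧ flavor (e, false) = .a := by
    rcases hec with ⟨rfl, rfl⟩ | ⟨rfl, rfl⟩ <;> exact ⟨rfl, rfl⟩
  -- `F` counts the edges labelled `e` issuing from `S`, and is unchanged along all other edges
  have hlet : ∀ (S : Set (G L)) (F : G L → ℤ), (∀ g d, (d = e → g ∉ S) → F (g * gen L d) = F g) →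
      (∀ g ∈ S, F (g * gen L e) = F g + 1) → ∀ g l,
        (F (g * letterVal L l) < F g → l = (e, false) ∧ g * letterVal L l ∈ S) ∧
        (F g < F (g * letterVal L l) → l = (e, true) ∧ g ∈ S) := by
    rintro S F h0 h1 g ⟨d, b⟩
    by_cases hd : d = e
    · subst hd
      cases b
      · by_cases hg : g * letterVal L (d, false) ∈ S
        · have := h1 _ hg
          simp only [letterVal, Bool.false_eq_true, if_false, inv_mul_cancel_right] at this hg ⊢
          exact ⟨fun _ => ⟨trivial, hg⟩, fun h => by omega⟩
        · have := h0 (g * letterVal L (d, false)) d (fun _ => hg)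
          simp only [letterVal, Bool.false_eq_true, if_false, inv_mul_cancel_right] at this hg ⊢
          exact ⟨fun h => by omega, fun h => by omega⟩
      · by_cases hg : g ∈ S
        · have := h1 _ hg
          simp only [letterVal, if_true]
          exact ⟨fun h => by omega, fun _ => ⟨trivial, hg⟩⟩
        · have := h0 g d (fun _ => hg)
          simp only [letterVal, if_true]
          exact ⟨fun h => by omega, fun h => by omega⟩
    · have : F (g * letterVal L (d, b)) = F g := by
        cases b
        · have := h0 (g * letterVal L (d, false)) d (fun h => absurd h hd)
          simpa [letterVal] using this.symm
        · simpa [letterVal] using h0 g d (fun h => absurd h hd)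
      exact ⟨fun h => by omega, fun h => by omega⟩
  cases b
  · obtain ⟨F, hF1, hFH, h0, h1⟩ := exists_crossing e c hec
      {g : G L | g * gen L e ∈ Subgroup.zpowers (gen L .a)} (fun g => by
        change g * gen L c * gen L e ∈ Subgroup.zpowers (gen L .a) ↔
          g * gen L e ∈ Subgroup.zpowers (gen L .a)
        simp only [mul_assoc, ← hc]
        rw [← mul_assoc, Subgroup.mul_mem_cancel_right _ (Subgroup.mem_zpowers _)])
    refine ⟨fun g => - F g, fun h hh => by simpa [hF1] using hFH h hh 1, ?_, fun g l h => ?_⟩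
    · have := h1 (gen L e)⁻¹ (by simp [one_mem])
      simp only [inv_mul_cancel, hF1] at this
      simp only [letterVal, Bool.false_eq_true, if_false]
      omega
    · obtain ⟨rfl, hg⟩ := (hlet _ F h0 h1 g l).2 (by simpa using h)
      rw [hfl.2]
      exact ⟨rfl, by simpa [letterVal] using hg⟩
  · obtain ⟨F, hF1, hFH, h0, h1⟩ := exists_crossing e c hec
      (Subgroup.zpowers (gen L c) : Set (G L)) (fun g =>
        Subgroup.mul_mem_cancel_right _ (Subgroup.mem_zpowers _))
    refine ⟨F, fun h hh => by simpa [hF1] using hFH h hh 1, ?_, fun g l h => ?_⟩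
    · have := h1 1 (one_mem _)
      simp only [one_mul, hF1] at this
      simp [letterVal, this]
    · obtain ⟨rfl, hg⟩ := (hlet _ F h0 h1 g l).1 h
      rw [hfl.1]
      exact ⟨rfl, hg⟩

/-- The word read along an escape from `H`. -/
structure IsEscapeWord (L : ℕ) (w : List Letter) : Prop where
  ne_nil : w ≠ []
  val_mem : wordVal L w ∈ H L
  take_notMem : ∀ i, 0 < i → i < w.length → wordVal L (w.take i) ∉ H L
  head_notToral : ∀ l ∈ w.head?, ¬ l.1.IsToral

/-- By the separation property of the edges of the Bass-Serre tree, an escape returns through the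
edge by which it left. -/
lemma IsEscapeWord.eq_conj {w : List Letter} (hw : IsEscapeWord L w) :
    ∃ e b v n, ¬ Gen.IsToral e ∧ w = (e, b) :: (v ++ [(e, !b)]) ∧
      wordVal L v = gen L (innerGen (e, b)) ^ n ∧
      wordVal L w = gen L (flavor (e, b)) ^ (n : ℤ) := by
  obtain _ | ⟨⟨e, b⟩, u⟩ := w
  · exact absurd rfl hw.ne_nil
  have he : ¬ e.IsToral := hw.head_notToral (e, b) rfl
  obtain ⟨F, hFH, hpos, hdec⟩ := exists_height (L := L) he b
  have hsub : Subgroup.zpowers (gen L (flavor (e, b))) ≤ H L :=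
    (Subgroup.zpowers_le).2 (gen_mem_H (flavor_isToral _))
  have hstay : ∀ i, i < u.length → 0 < F (wordVal L (((e, b) :: u).take (i + 1))) := by
    intro i
    induction i with
    | zero => simpa using fun _ => hpos
    | succ i ih =>
      intro hi
      have htake : ((e, b) :: u).take (i + 1 + 1) = ((e, b) :: u).take (i + 1) ++ [u[i]] := by
        simp [List.take_add_one, List.getElem?_eq_getElem (show i < u.length by omega)]
      have h := ih (by omega)
      by_contra hneg
      rw [htake, wordVal_append, wordVal_cons, wordVal_nil, mul_one] at hneg
      have hmem := hsub (hdec _ u[i] ((not_lt.1 hneg).trans_lt h)).2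
      refine hw.take_notMem (i + 1 + 1) (by omega) (by simpa using hi) ?_
      rw [htake, wordVal_append, wordVal_cons, wordVal_nil, mul_one]
      exact hmem
  obtain rfl | ⟨v, l, rfl⟩ := List.eq_nil_or_concat' u
  · have := hFH _ hw.val_mem
    simp only [wordVal_cons, wordVal_nil, mul_one] at this
    omega
  have h1 := hstay v.length (by simp)
  have h2 := hFH _ hw.val_mem
  have h3 : ((e, b) :: (v ++ [l])).take (v.length + 1) = (e, b) :: v := by simp
  rw [h3] at h1
  rw [← List.cons_append, wordVal_append, wordVal_cons (w := []), wordVal_nil, mul_one] at h2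
  obtain ⟨rfl, n, hn⟩ := hdec (wordVal L ((e, b) :: v)) l (by omega)
  refine ⟨e, b, v, n, he, rfl, ?_, ?_⟩
  · have h4 := conj_innerGen (L := L) he b n
    have h5 : gen L (flavor (e, b)) ^ n = wordVal L ((e, b) :: v) * letterVal L (e, !b) := hn
    rw [← h4, wordVal_cons] at h5
    exact (mul_left_cancel (mul_right_cancel h5)).symm
  · rw [← List.cons_append, wordVal_append, wordVal_cons (w := []), wordVal_nil, mul_one]
    exact hn.symm

/-- A word consisting of a single letter of `H`, or read along an escape from `H`. -/
def IsPiece (L : ℕ) (w : List Letter) : Prop :=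
  (∃ l : Letter, w = [l] ∧ l.1.IsToral) ∨ IsEscapeWord L w

lemma IsPiece.ne_nil {w : List Letter} (hw : IsPiece L w) : w ≠ [] := by
  rcases hw with ⟨l, rfl, -⟩ | hw
  · simp
  · exact hw.ne_nil

lemma IsPiece.val_mem {w : List Letter} (hw : IsPiece L w) : wordVal L w ∈ H L := by
  rcases hw with ⟨l, rfl, hl⟩ | hw
  · simpa using letterVal_mem_H hl
  · exact hw.val_mem

lemma IsPiece.take_notMem {w : List Letter} (hw : IsPiece L w) (i : ℕ) (h0 : 0 < i)
    (hi : i < w.length) : wordVal L (w.take i) ∉ H L := by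
  rcases hw with ⟨l, rfl, -⟩ | hw
  · simp at hi; omega
  · exact hw.take_notMem i h0 hi

/-- A path with endpoints in `H` is a concatenation of edges in `H` and escapes. -/
lemma exists_pieces (w : List Letter) (hw : wordVal L w ∈ H L) :
    ∃ ps : List (List Letter), ps.flatten = w ∧ ∀ p ∈ ps, IsPiece L p := by
  classical
  induction hn : w.length using Nat.strong_induction_on generalizing w with
  | _ n ih =>
    obtain _ | ⟨l, u⟩ := w
    · exact ⟨[], rfl, by simp⟩
    -- it suffices to split off the first piece
    suffices h : ∃ p q, l :: u = p ++ q ∧ IsPiece L p by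
      obtain ⟨p, q, hpq, hp⟩ := h
      have hlen : p.length ≠ 0 := fun h => hp.ne_nil (List.length_eq_zero_iff.1 h)
      have hq : wordVal L q ∈ H L := by
        rw [hpq, wordVal_append] at hw
        exact (Subgroup.mul_mem_cancel_left _ hp.val_mem).1 hw
      have hlen' := congrArg List.length hpq
      rw [List.length_append] at hlen'
      obtain ⟨ps, rfl, hps⟩ := ih q.length (by omega) q hq rfl
      exact ⟨p :: ps, hpq.symm, by simpa using ⟨hp, hps⟩⟩
    by_cases hl : l.1.IsToral
    · exact ⟨[l], u, rfl, Or.inl ⟨l, rfl, hl⟩⟩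
    have hex : ∃ i, 0 < i ∧ wordVal L ((l :: u).take i) ∈ H L :=
      ⟨(l :: u).length, by simp, by rwa [List.take_length]⟩
    have hspec := Nat.find_spec hex
    have hmin := fun i (hi : i < Nat.find hex) => Nat.find_min hex hi
    refine ⟨(l :: u).take (Nat.find hex), (l :: u).drop (Nat.find hex),
      (List.take_append_drop _ _).symm, Or.inr ⟨?_, hspec.2, fun i h0 hi => ?_, ?_⟩⟩
    · simp [hspec.1.ne']
    · rw [List.length_take] at hi
      rw [List.take_take, min_eq_left (by omega)]
      exact fun h => hmin i (by omega) ⟨h0, h⟩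
    · intro l' hl'
      obtain ⟨k, hk⟩ := Nat.exists_eq_succ_of_ne_zero hspec.1.ne'
      rw [hk] at hl'
      simp at hl'
      rwa [← hl']

/-! ### Lengths of the pieces of each flavor -/

/-- The flavor of a piece, read off from its first letter. -/
def wordFlavor : List Letter → Gen
  | [] => .a
  | l :: _ => flavor l

lemma wordFlavor_isToral (p : List Letter) : (wordFlavor p).IsToral := by
  cases p
  · trivial
  · exact flavor_isToral _

open Classical in
/-- The total length of the words of flavor `e` in a list of words. -/
noncomputable def total (L : ℕ) (e : Gen) (ps : List (List Letter)) : ℕ :=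
  (ps.map fun p => if wordFlavor p = e then wordLen L p else 0).sum

@[simp] lemma total_nil (e : Gen) : total L e [] = 0 := rfl

open Classical in
lemma total_cons (e : Gen) (p : List Letter) (ps : List (List Letter)) :
    total L e (p :: ps) = (if wordFlavor p = e then wordLen L p else 0) + total L e ps := by
  simp [total]

@[simp] lemma total_append (e : Gen) (ps qs : List (List Letter)) :
    total L e (ps ++ qs) = total L e ps + total L e qs := by simp [total]

lemma wordLen_le_total {p : List Letter} {ps : List (List Letter)} (hp : p ∈ ps) :
    wordLen L p ≤ total L (wordFlavor p) ps := by
  classical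
  unfold total
  have h := List.single_le_sum (l := ps.map fun q => if wordFlavor q = wordFlavor p
    then wordLen L q else 0) (fun _ _ => Nat.zero_le _) _ (List.mem_map_of_mem hp)
  simpa using h

lemma wordLen_flatten (ps : List (List Letter)) :
    wordLen L ps.flatten = total L .a ps + total L .x ps + total L .y ps := by
  induction ps with
  | nil => rfl
  | cons p ps ih =>
    rw [List.flatten_cons, wordLen_append, ih, total_cons, total_cons, total_cons]
    have h := wordFlavor_isToral p
    cases hp : wordFlavor p <;> simp_all [Gen.IsToral] <;> omega

/-- A bound relating exponents and lengths that is additive and holds for all pieces holds for the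
total exponents and total lengths of each flavor. -/
lemma exists_toral (Q : Gen → ℤ → ℕ → Prop) (h0 : ∀ e, Q e 0 0)
    (hadd : ∀ e n m u v, Q e n u → Q e m v → Q e (n + m) (u + v)) (ps : List (List Letter))
    (hps : ∀ p ∈ ps, ∃ n : ℤ, wordVal L p = gen L (wordFlavor p) ^ n ∧
      Q (wordFlavor p) n (wordLen L p)) :
    ∃ i j k, wordVal L ps.flatten = toral L i j k ∧
      Q .a i (total L .a ps) ∧ Q .x j (total L .x ps) ∧ Q .y k (total L .y ps) := by
  induction ps with
  | nil => exact ⟨0, 0, 0, by simp [toral], h0 _, h0 _, h0 _⟩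
  | cons p ps ih =>
    obtain ⟨i, j, k, hv, hi, hj, hk⟩ := ih fun q hq => hps q (List.mem_cons_of_mem _ hq)
    obtain ⟨n, hn, hQ⟩ := hps p List.mem_cons_self
    rw [List.flatten_cons, wordVal_append, hn, hv]
    have h := wordFlavor_isToral p
    simp only [total_cons]
    cases hp : wordFlavor p <;> rw [hp] at h hQ
    · exact ⟨n + i, j, k, by rw [← toral_a, toral_mul]; simp, by simpa using hadd _ _ _ _ _ hQ hi,
        by simpa using hj, by simpa using hk⟩
    · exact ⟨i, n + j, k, by rw [← toral_x, toral_mul]; simp, by simpa using hi,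
        by simpa using hadd _ _ _ _ _ hQ hj, by simpa using hk⟩
    · exact ⟨i, j, n + k, by rw [← toral_y, toral_mul]; simp, by simpa using hi,
        by simpa using hj, by simpa using hadd _ _ _ _ _ hQ hk⟩
    · exact h.elim
    · exact h.elim

/-! ### The norms of the powers of `a`, `x` and `y` -/

/-- The norm of `a ^ n`. -/
noncomputable def aNorm (L : ℕ) (n : ℤ) : ℕ := norm L (gen L .a ^ n)

@[simp] lemma aNorm_zero : aNorm L 0 = 0 := by simp [aNorm, norm_one]

lemma aNorm_add_le (n m : ℤ) : aNorm L (n + m) ≤ aNorm L n + aNorm L m := by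
  unfold aNorm
  rw [zpow_add]
  exact norm_mul_le _ _

lemma aNorm_neg (n : ℤ) : aNorm L (-n) = aNorm L n := by
  unfold aNorm
  rw [zpow_neg, norm_inv]

lemma aNorm_le_natAbs (n : ℤ) : aNorm L n ≤ n.natAbs :=
  (norm_zpow_le _ n).trans <|
    (Nat.mul_le_mul_left n.natAbs (norm_gen_le (L := L) .a)).trans_eq (mul_one _)

lemma norm_flavor_le {e : Gen} (he : ¬ e.IsToral) (n : ℤ) :
    norm L (gen L (flavor (e, true)) ^ n) ≤ aNorm L n + 2 := by
  have hlen : ∀ b, norm L (letterVal L (e, b)) ≤ 1 := fun b => by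
    have h := norm_wordVal_le (L := L) [(e, b)]
    have : e.len L = 1 := by cases e <;> simp_all [Gen.IsToral, Gen.len]
    simpa [this] using h
  have hin : innerGen (e, true) = .a := by cases e <;> rfl
  rw [← conj_innerGen he, hin]
  have h1 := norm_mul_le (letterVal L (e, true) * gen L .a ^ n) (letterVal L (e, !true))
  have h2 := norm_mul_le (letterVal L (e, true)) (gen L .a ^ n)
  have h3 := hlen true
  have h4 := hlen (!true)
  unfold aNorm
  omega

lemma norm_x_le (n : ℤ) : norm L (gen L .x ^ n) ≤ aNorm L n + 2 :=
  norm_flavor_le (e := .s) id n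

lemma norm_y_le (n : ℤ) : norm L (gen L .y ^ n) ≤ aNorm L n + 2 :=
  norm_flavor_le (e := .t) id n

lemma norm_toral_le (i j k : ℤ) :
    norm L (toral L i j k) ≤ aNorm L i + norm L (gen L .x ^ j) + norm L (gen L .y ^ k) :=
  (norm_mul_le _ _).trans (Nat.add_le_add_right (norm_mul_le _ _) _)

lemma natAbs_exponent_letter {e : Gen} (b : Bool) :
    ∃ n : ℤ, n.natAbs = 1 ∧ letterVal L (e, b) = gen L e ^ n := by
  cases b
  · exact ⟨-1, rfl, by simp [letterVal]⟩
  · exact ⟨1, rfl, by simp [letterVal]⟩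

lemma IsEscapeWord.len_eq {e : Gen} (he : ¬ e.IsToral) (b : Bool) (v : List Letter) :
    wordLen L ((e, b) :: (v ++ [(e, !b)])) = wordLen L v + 2 := by
  have : e.len L = 1 := by cases e <;> simp_all [Gen.IsToral, Gen.len]
  simp [this]; omega

/-- Each piece of flavor `x` or `y` is at least `2` longer than the power of `a` with the same
exponent. -/
lemma IsPiece.exists_exponent_of_ne (hL : 3 ≤ L) {p : List Letter} (hp : IsPiece L p) :
    ∃ n : ℤ, wordVal L p = gen L (wordFlavor p) ^ n ∧
      (wordFlavor p ≠ .a → aNorm L n + 2 ≤ wordLen L p) := by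
  rcases hp with ⟨⟨e, b⟩, rfl, he⟩ | hp
  · obtain ⟨n, hn, hv⟩ := natAbs_exponent_letter (L := L) (e := e) b
    have hfl : wordFlavor [(e, b)] = e := by cases e <;> first | rfl | exact he.elim
    refine ⟨n, by rw [hfl]; simpa using hv, fun hne => ?_⟩
    have h1 := aNorm_le_natAbs (L := L) n
    have h2 : e.len L = L := by
      rw [hfl] at hne
      cases e <;> first | rfl | exact he.elim | exact absurd rfl hne
    simp only [wordLen_cons, wordLen_nil, h2]
    omega
  · obtain ⟨e, b, v, n, he, rfl, hv, hw⟩ := hp.eq_conj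
    refine ⟨n, hw, fun hne => ?_⟩
    have hin : innerGen (e, b) = .a := by
      cases e <;> cases b <;> first | rfl | exact absurd rfl hne
    rw [hin] at hv
    have := norm_wordVal_le (L := L) v
    rw [IsEscapeWord.len_eq he]
    rw [hv] at this
    exact Nat.add_le_add_right this 2

/-- The bound on the exponent of a word of flavor `x` or `y` in terms of its length. -/
def ExponentBound (L : ℕ) (n : ℤ) (u : ℕ) : Prop := n = 0 ∨ aNorm L n + 2 ≤ u

lemma ExponentBound.add {n m : ℤ} {u v : ℕ} (hn : ExponentBound L n u)
    (hm : ExponentBound L m v) : ExponentBound L (n + m) (u + v) := by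
  have h := aNorm_add_le (L := L) n m
  rcases hn with rfl | hn
  · rcases hm with rfl | hm
    · exact Or.inl rfl
    · right; rw [zero_add]; omega
  · rcases hm with rfl | hm
    · right; rw [add_zero]; omega
    · right; omega

lemma ExponentBound.aNorm_le {n : ℤ} {u : ℕ} (hn : ExponentBound L n u) : aNorm L n ≤ u := by
  rcases hn with rfl | hn
  · simp
  · omega

/-- A power of `x` or `y` is at least as long as the power of `a` with the same exponent. -/
lemma aNorm_le_norm (hL : 3 ≤ L) (n : ℤ) :
    aNorm L n ≤ norm L (gen L .x ^ n) ∧ aNorm L n ≤ norm L (gen L .y ^ n) := by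
  -- `x ^ n = a ^ i * x ^ j * y ^ k` forces `n = j - k`, so the pieces of flavors `x` and `y`
  -- suffice
  have key : ∀ g ∈ H L, ∃ i j k, g = toral L i j k ∧ aNorm L j + aNorm L k ≤ norm L g := by
    intro g hg
    obtain ⟨w, rfl, hw⟩ := exists_geodesic g
    obtain ⟨ps, rfl, hps⟩ := exists_pieces w hg
    obtain ⟨i, j, k, h, -, hj, hk⟩ := exists_toral (L := L)
      (fun e n u => e = .a ∨ ExponentBound L n u) (fun _ => Or.inr (Or.inl rfl))
      (fun e n m u v h1 h2 => h1.elim Or.inl fun h1 => h2.imp_right h1.add) ps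
      (fun p hp => by
        obtain ⟨n, hn, h⟩ := (hps p hp).exists_exponent_of_ne hL
        exact ⟨n, hn, (em _).imp_right fun hne => Or.inr (h hne)⟩)
    have hj' := (hj.resolve_left (by simp)).aNorm_le
    have hk' := (hk.resolve_left (by simp)).aNorm_le
    refine ⟨i, j, k, h, ?_⟩
    rw [← hw, wordLen_flatten]
    omega
  constructor
  · obtain ⟨i, j, k, h, hle⟩ := key (gen L .x ^ n) (zpow_mem (gen_mem_H (e := .x) trivial) n)
    rw [← toral_x] at h
    have hn : n = j + -k := by have := (toral_inj h).2; omega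
    have := aNorm_add_le (L := L) j (-k)
    rw [aNorm_neg, ← hn] at this
    exact this.trans hle
  · obtain ⟨i, j, k, h, hle⟩ := key (gen L .y ^ n) (zpow_mem (gen_mem_H (e := .y) trivial) n)
    rw [← toral_y] at h
    have hn : n = k + -j := by have := (toral_inj h).2; omega
    have := aNorm_add_le (L := L) k (-j)
    rw [aNorm_neg, ← hn] at this
    omega

/-- All pieces, except single edges labelled `a`, are at least `2` longer than the power of `a`
with the same exponent. For an escape of flavor `a`, the part between its first and its last edge
has value in `⟨x⟩` or `⟨y⟩`. -/
lemma IsPiece.exists_exponent (hL : 3 ≤ L) {p : List Letter} (hp : IsPiece L p) :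
    ∃ n : ℤ, wordVal L p = gen L (wordFlavor p) ^ n ∧
      (aNorm L n + 2 ≤ wordLen L p ∨ wordFlavor p = .a ∧ n.natAbs ≤ wordLen L p) := by
  by_cases hfl : wordFlavor p = .a
  · rcases hp with ⟨⟨e, b⟩, rfl, he⟩ | hp
    · obtain ⟨n, hn, hv⟩ := natAbs_exponent_letter (L := L) (e := e) b
      obtain rfl : e = .a := by
        rw [← hfl]; cases e <;> first | rfl | exact he.elim
      exact ⟨n, by simpa [hfl] using hv, Or.inr ⟨hfl, by simp [hn, Gen.len]⟩⟩
    · obtain ⟨e, b, v, n, he, rfl, hv, hw⟩ := hp.eq_conj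
      refine ⟨n, hw, Or.inl ?_⟩
      have hv' := norm_wordVal_le (L := L) v
      rw [hv] at hv'
      have h1 : aNorm L n ≤ norm L (gen L (innerGen (e, b)) ^ n) := by
        cases hin : innerGen (e, b)
        · exact le_rfl
        · exact (aNorm_le_norm hL n).1
        · exact (aNorm_le_norm hL n).2
        all_goals cases e <;> cases b <;> cases hin
      rw [IsEscapeWord.len_eq he]
      omega
  · obtain ⟨n, hn, h⟩ := hp.exists_exponent_of_ne hL
    exact ⟨n, hn, Or.inl (h hfl)⟩

/-- The exponents of a word with value in `H`, grouped by flavor, are bounded by the lengths of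
the pieces of the respective flavors. -/
lemma exists_toral_of_pieces (hL : 3 ≤ L) {ps : List (List Letter)} (hps : ∀ p ∈ ps, IsPiece L p) :
    ∃ i j k, wordVal L ps.flatten = toral L i j k ∧
      (aNorm L i + 2 ≤ total L .a ps ∨ i.natAbs ≤ total L .a ps) ∧
      ExponentBound L j (total L .x ps) ∧ ExponentBound L k (total L .y ps) := by
  obtain ⟨i, j, k, h, hi, hj, hk⟩ := exists_toral (L := L)
    (fun e n u => ExponentBound L n u ∨ e = .a ∧ n.natAbs ≤ u)
    (fun _ => Or.inl (Or.inl rfl))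
    (fun e n m u v h1 h2 => by
      have h3 := aNorm_le_natAbs (L := L) n
      have h4 := aNorm_le_natAbs (L := L) m
      have h5 := aNorm_add_le (L := L) n m
      rcases h1 with h1 | ⟨rfl, h1⟩
      · rcases h2 with h2 | ⟨rfl, h2⟩
        · exact Or.inl (h1.add h2)
        · rcases h1 with rfl | h1
          · exact Or.inr ⟨rfl, by rw [zero_add]; omega⟩
          · exact Or.inl (Or.inr (by omega))
      · rcases h2 with (rfl | h2) | ⟨-, h2⟩
        · exact Or.inr ⟨rfl, by rw [add_zero]; omega⟩
        · exact Or.inl (Or.inr (by omega))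
        · exact Or.inr ⟨rfl, by omega⟩) ps
    (fun p hp => by
      obtain ⟨n, hn, h⟩ := (hps p hp).exists_exponent hL
      exact ⟨n, hn, h.imp_left Or.inr⟩)
  refine ⟨i, j, k, h, ?_, hj.resolve_right (by simp), hk.resolve_right (by simp)⟩
  rcases hi with (rfl | hi) | ⟨-, hi⟩
  · exact Or.inr (by simp)
  · exact Or.inl hi
  · exact Or.inr hi

/-- The upper bound from the relation `a ^ (L * m) = x ^ m * y ^ m`. -/
lemma aNorm_add_mul_le (i m : ℤ) : aNorm L (i + L * m) ≤ aNorm L i + 2 * aNorm L m + 4 := by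
  have h : gen L .a ^ (i + L * m) = toral L i m m := by
    rw [← toral_a, toral_eq, zero_add]
  have h1 := norm_toral_le (L := L) i m m
  have h2 := norm_x_le (L := L) m
  have h3 := norm_y_le (L := L) m
  unfold aNorm at *
  rw [h]
  omega

/-- A bounded power of `a` is all that can be geodesic as a word in the letter `a`: beyond this
bound, rewriting `a ^ (2 * L)` as `s * a ^ 2 * s⁻¹ * t * a ^ 2 * t⁻¹` saves length. -/
lemma natAbs_le_of_le_aNorm (hL : 5 ≤ L) {r : ℤ} (hr : r.natAbs ≤ aNorm L r) :
    r.natAbs ≤ 2 * L := by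
  by_contra hlt
  rcases le_total 0 r with h | h
  · have h1 := aNorm_add_mul_le (L := L) (r - L * 2) 2
    rw [sub_add_cancel] at h1
    have h2 := aNorm_le_natAbs (L := L) (r - L * 2)
    have h3 := aNorm_le_natAbs (L := L) 2
    omega
  · have h1 := aNorm_add_mul_le (L := L) (r + L * 2) (-2)
    rw [mul_neg, add_neg_cancel_right] at h1
    have h2 := aNorm_le_natAbs (L := L) (r + L * 2)
    have h3 := aNorm_le_natAbs (L := L) (-2)
    omega

/-- The recursion for the norms of the powers of `a`: a long geodesic for `a ^ n` spells
`x ^ m`, `y ^ m` and a bounded power of `a`. -/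
lemma aNorm_recursion (hL : 5 ≤ L) (n : ℤ) :
    (n.natAbs ≤ 2 * L ∧ aNorm L n = n.natAbs) ∨
      ∃ i m : ℤ, n = i + L * m ∧ i.natAbs ≤ 2 * L ∧
        aNorm L n = i.natAbs + 2 * aNorm L m + 4 := by
  obtain ⟨w, hw, hlen⟩ := exists_geodesic (gen L .a ^ n)
  obtain ⟨ps, rfl, hps⟩ := exists_pieces w (hw ▸ zpow_mem (gen_mem_H (e := .a) trivial) n)
  obtain ⟨i, j, k, h, hi, hj, hk⟩ := exists_toral_of_pieces (by omega) hps
  rw [hw, ← toral_a] at h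
  obtain ⟨hn, hjk⟩ := toral_inj h
  obtain rfl : j = k := by omega
  have hn' : n = i + L * j := by simpa using hn
  change _ = aNorm L n at hlen
  rw [wordLen_flatten] at hlen
  have hup := aNorm_add_mul_le (L := L) i j
  rw [← hn'] at hup
  have hi' := aNorm_le_natAbs (L := L) i
  by_cases hj0 : j = 0
  · obtain rfl : n = i := by simpa [hj0] using hn'
    have : n.natAbs ≤ aNorm L n := by omega
    exact Or.inl ⟨natAbs_le_of_le_aNorm hL this, by omega⟩
  · have hj' := hj.resolve_left hj0
    have hk' := hk.resolve_left hj0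
    have : i.natAbs ≤ aNorm L i := by omega
    exact Or.inr ⟨i, j, hn', natAbs_le_of_le_aNorm hL this, by omega⟩

lemma aNorm_le_aNorm_mul (hL : 5 ≤ L) (k : ℤ) : aNorm L k ≤ aNorm L (L * k) := by
  have hmul : ∀ z : ℤ, z.natAbs ≤ ((L : ℤ) * z).natAbs := fun z => by
    rw [Int.natAbs_mul, Int.natAbs_natCast]
    exact Nat.le_mul_of_pos_left _ (by omega)
  rcases aNorm_recursion hL (L * k) with ⟨-, h⟩ | ⟨i, m, hn, -, h⟩
  · rw [h]
    exact (aNorm_le_natAbs k).trans (hmul k)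
  · have h1 := aNorm_add_le (L := L) (k - m) m
    have h2 := aNorm_le_natAbs (L := L) (k - m)
    have h3 := hmul (k - m)
    rw [show (L : ℤ) * (k - m) = i by rw [mul_sub, hn]; ring] at h3
    rw [sub_add_cancel] at h1
    omega

/-- `Spelled L d n ℓ` says that `d` applications of the rewriting `a ^ (L * m) = x ^ m * y ^ m`,
with `x ^ m = s * a ^ m * s⁻¹` and `y ^ m = t * a ^ m * t⁻¹`, give a word of length at most `ℓ`
for `a ^ n`. In terms of numbers, `n` has an expansion in base `L`, with `d + 1` integral
digits `i` of arbitrary size, the `q`-th of which contributes `2 ^ q * |i|` to the length. -/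
def Spelled (L : ℕ) : ℕ → ℤ → ℕ → Prop
  | 0, n, l => n.natAbs ≤ l
  | d + 1, n, l => ∃ (i m : ℤ) (l' : ℕ), n = i + L * m ∧ Spelled L d m l' ∧
      i.natAbs + 2 * l' + 4 ≤ l

lemma Spelled.aNorm_le {d : ℕ} {n : ℤ} {l : ℕ} (h : Spelled L d n l) : aNorm L n ≤ l := by
  induction d generalizing n l with
  | zero => exact (aNorm_le_natAbs n).trans h
  | succ d ih =>
    obtain ⟨i, m, l', rfl, h, hl⟩ := h
    have h1 := ih h
    have h2 := aNorm_add_mul_le (L := L) i m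
    have h3 := aNorm_le_natAbs (L := L) i
    omega

/-- Geodesics for powers of `a` are obtained in this way, with bounded digits, so that the number
of rewritings determines their length up to a factor. -/
lemma exists_spelled (hL : 5 ≤ L) (n : ℤ) :
    ∃ d, Spelled L d n (aNorm L n) ∧ aNorm L n + (2 * L + 4) ≤ (4 * L + 4) * 2 ^ d := by
  induction hN : aNorm L n using Nat.strong_induction_on generalizing n with
  | _ N ih =>
    subst hN
    rcases aNorm_recursion hL n with ⟨hn, h⟩ | ⟨i, m, hn, hi, h⟩
    · exact ⟨0, h.ge, by omega⟩
    · obtain ⟨d, hd, hle⟩ := ih (aNorm L m) (by omega) m rfl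
      refine ⟨d + 1, ⟨i, m, aNorm L m, hn, hd, h.ge⟩, ?_⟩
      rw [pow_succ, ← mul_assoc]
      omega

/-- Adding expansions digit by digit saves the cost of the conjugations in the shorter one. -/
lemma Spelled.add {d d' : ℕ} (hdd : d' ≤ d) {n m : ℤ} {l l' : ℕ} (h : Spelled L d n l)
    (h' : Spelled L d' m l') :
    ∃ l'', Spelled L d (n + m) l'' ∧ l'' + 4 * 2 ^ d' ≤ l + l' + 4 := by
  induction d generalizing d' n m l l' with
  | zero =>
    obtain rfl : d' = 0 := by omega
    exact ⟨l + l', (Int.natAbs_add_le n m).trans (Nat.add_le_add h h'), by omega⟩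
  | succ d ih =>
    obtain ⟨i, p, u, rfl, hp, hu⟩ := h
    cases d' with
    | zero =>
      refine ⟨l + l', ⟨i + m, p, u, by ring, hp, ?_⟩, by omega⟩
      have h1 := Int.natAbs_add_le i m
      have h2 : m.natAbs ≤ l' := h'
      omega
    | succ d' =>
      obtain ⟨i', p', u', rfl, hp', hu'⟩ := h'
      obtain ⟨u'', hs, hle⟩ := ih (by omega) hp hp'
      refine ⟨(i + i').natAbs + 2 * u'' + 4, ⟨i + i', p + p', u'', by ring, hs, le_rfl⟩, ?_⟩
      have h1 := Int.natAbs_add_le i i'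
      rw [pow_succ]
      omega

/-- The norm on the powers of `a` is strictly subadditive, by an amount proportional to the
shorter of the two powers. -/
lemma aNorm_add_strict (hL : 5 ≤ L) (n m : ℤ) :
    (L + 1) * aNorm L (n + m) + min (aNorm L n) (aNorm L m) ≤
      (L + 1) * (aNorm L n + aNorm L m + 4) := by
  obtain ⟨d, hd, hdn⟩ := exists_spelled hL n
  obtain ⟨d', hd', hdm⟩ := exists_spelled hL m
  rcases le_total d' d with h | h
  · obtain ⟨l, hl, hle⟩ := hd.add h hd'
    have h1 := hl.aNorm_le
    have h2 : min (aNorm L n) (aNorm L m) ≤ (L + 1) * (4 * 2 ^ d') := by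
      refine (min_le_right _ _).trans ?_
      nlinarith
    calc _ ≤ (L + 1) * (aNorm L (n + m) + 4 * 2 ^ d') := by rw [mul_add]; omega
      _ ≤ _ := Nat.mul_le_mul_left _ (by omega)
  · obtain ⟨l, hl, hle⟩ := hd'.add h hd
    have h1 := hl.aNorm_le
    rw [add_comm m n] at h1
    have h2 : min (aNorm L n) (aNorm L m) ≤ (L + 1) * (4 * 2 ^ d) := by
      refine (min_le_left _ _).trans ?_
      nlinarith
    calc _ ≤ (L + 1) * (aNorm L (n + m) + 4 * 2 ^ d) := by rw [mul_add]; omega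
      _ ≤ _ := Nat.mul_le_mul_left _ (by omega)

/-! ### Words that are nearly geodesic -/

/-- By strict subadditivity, two lengths that are nearly additive cannot both be large. -/
lemma min_le_of_le_aNorm_add (hL : 5 ≤ L) {n m : ℤ} {u v D : ℕ} (hn : aNorm L n ≤ u)
    (hm : aNorm L m ≤ v) (h : u + v ≤ aNorm L (n + m) + (D + 2)) :
    min u v ≤ (2 * L + 5) * (D + 6) := by
  have h1 := aNorm_add_strict hL n m
  have h2 := aNorm_add_le (L := L) n m
  have h3 : (L + 1) * (u + v) ≤ (L + 1) * (aNorm L (n + m) + (D + 2)) := Nat.mul_le_mul_left _ h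
  have h4 : (L + 1) * (aNorm L n + aNorm L m) ≤ (L + 1) * (u + v) :=
    Nat.mul_le_mul_left _ (by omega)
  have h5 : min (aNorm L n) (aNorm L m) ≤ (L + 1) * (D + 6) := by
    simp only [mul_add] at h1 h3 h4 ⊢
    omega
  have h6 : min u v ≤ min (aNorm L n) (aNorm L m) + (D + 2) := by omega
  calc min u v ≤ (L + 1) * (D + 6) + (D + 2) := by omega
    _ ≤ _ := by nlinarith

/-- An element of `H` with long parts in `⟨a⟩` and in `⟨x⟩` is shortened by rewriting the power
of `a` as `x ^ p * y ^ p`, up to a bounded power of `a`, and combining the powers of `x`. The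
number `q` is the norm of `a ^ p`. -/
lemma norm_toral_add_min_le_x (hL : 5 ≤ L) (i j k : ℤ) :
    ∃ q, aNorm L i ≤ 2 * L + 4 + 2 * q ∧
      (L + 1) * norm L (toral L i j k) + min q (aNorm L j) ≤
        (L + 1) * (aNorm L i + aNorm L j + 4 + norm L (gen L .y ^ k)) := by
  rcases aNorm_recursion hL i with ⟨h1, h2⟩ | ⟨r, p, rfl, hr, h⟩
  · refine ⟨0, by omega, ?_⟩
    have h3 := norm_toral_le (L := L) i j k
    have h4 := norm_x_le (L := L) j
    rw [Nat.zero_min, add_zero]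
    exact Nat.mul_le_mul_left _ (by omega)
  · refine ⟨aNorm L p, by omega, ?_⟩
    have h1 := norm_toral_le (L := L) r (j + p) (k + p)
    rw [← toral_eq] at h1
    have h2 := norm_x_le (L := L) (j + p)
    have h3 := norm_mul_le (gen L .y ^ k) (gen L .y ^ p)
    rw [← zpow_add] at h3
    have h4 := norm_y_le (L := L) p
    have h5 := aNorm_le_natAbs (L := L) r
    have h6 := aNorm_add_strict hL j p
    have h7 : norm L (toral L (r + L * p) j k) + aNorm L p ≤
        aNorm L (r + L * p) + aNorm L (j + p) + norm L (gen L .y ^ k) := by omega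
    have h8 := Nat.mul_le_mul_left (L + 1) h7
    rw [min_comm] at h6
    simp only [mul_add] at h6 h8 ⊢
    omega

/-- The mirror image of `norm_toral_add_min_le_x` under exchanging `x` and `y`. -/
lemma norm_toral_add_min_le_y (hL : 5 ≤ L) (i j k : ℤ) :
    ∃ q, aNorm L i ≤ 2 * L + 4 + 2 * q ∧
      (L + 1) * norm L (toral L i j k) + min q (aNorm L k) ≤
        (L + 1) * (aNorm L i + aNorm L k + 4 + norm L (gen L .x ^ j)) := by
  rcases aNorm_recursion hL i with ⟨h1, h2⟩ | ⟨r, p, rfl, hr, h⟩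
  · refine ⟨0, by omega, ?_⟩
    have h3 := norm_toral_le (L := L) i j k
    have h4 := norm_y_le (L := L) k
    rw [Nat.zero_min, add_zero]
    exact Nat.mul_le_mul_left _ (by omega)
  · refine ⟨aNorm L p, by omega, ?_⟩
    have h1 := norm_toral_le (L := L) r (j + p) (k + p)
    rw [← toral_eq] at h1
    have h2 := norm_y_le (L := L) (k + p)
    have h3 := norm_mul_le (gen L .x ^ j) (gen L .x ^ p)
    rw [← zpow_add] at h3
    have h4 := norm_x_le (L := L) p
    have h5 := aNorm_le_natAbs (L := L) r
    have h6 := aNorm_add_strict hL k p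
    have h7 : norm L (toral L (r + L * p) j k) + aNorm L p ≤
        aNorm L (r + L * p) + aNorm L (k + p) + norm L (gen L .x ^ j) := by omega
    have h8 := Nat.mul_le_mul_left (L + 1) h7
    rw [min_comm] at h6
    simp only [mul_add] at h6 h8 ⊢
    omega

lemma le_or_le_of_min_le {q A D u v : ℕ} (h : min q u ≤ (L + 1) * (D + 4))
    (hq : A ≤ 2 * L + 4 + 2 * q + D) (hv : v ≤ u + (D + 2)) :
    A ≤ (2 * L + 5) * (D + 6) ∨ v ≤ (2 * L + 5) * (D + 6) := by
  rcases min_le_iff.1 h with h | h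
  · left; nlinarith
  · right; nlinarith

lemma ExponentBound.norm_x_le {n : ℤ} {u : ℕ} (h : ExponentBound L n u) :
    norm L (gen L .x ^ n) ≤ u := by
  rcases h with rfl | h
  · simp [norm_one]
  · exact (Snowflake.norm_x_le n).trans h

lemma ExponentBound.norm_y_le {n : ℤ} {u : ℕ} (h : ExponentBound L n u) :
    norm L (gen L .y ^ n) ≤ u := by
  rcases h with rfl | h
  · simp [norm_one]
  · exact (Snowflake.norm_y_le n).trans h

/-- In a word with value in `H` whose length exceeds the norm of its value by `D`, the pieces of
flavor `a` and those of flavor `x` or `y` cannot both have large total length, and the total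
lengths are determined by the exponents, all up to errors linear in `D`. -/
lemma exists_toral_of_nearGeodesic (hL : 5 ≤ L) {ps : List (List Letter)}
    (hps : ∀ p ∈ ps, IsPiece L p) {D : ℕ}
    (hD : wordLen L ps.flatten ≤ norm L (wordVal L ps.flatten) + D) :
    ∃ i j k, wordVal L ps.flatten = toral L i j k ∧
      (aNorm L i ≤ total L .a ps ∧ total L .a ps ≤ aNorm L i + (D + 2)) ∧
      (aNorm L j ≤ total L .x ps ∧ total L .x ps ≤ aNorm L j + (D + 2)) ∧
      (aNorm L k ≤ total L .y ps ∧ total L .y ps ≤ aNorm L k + (D + 2)) ∧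
      (total L .a ps ≤ (2 * L + 5) * (D + 6) ∨ total L .x ps ≤ (2 * L + 5) * (D + 6)) ∧
      (total L .a ps ≤ (2 * L + 5) * (D + 6) ∨ total L .y ps ≤ (2 * L + 5) * (D + 6)) := by
  obtain ⟨i, j, k, h, hi, hj, hk⟩ := exists_toral_of_pieces (by omega) hps
  rw [h, wordLen_flatten] at hD
  have h1 := norm_toral_le (L := L) i j k
  have h2 := hj.norm_x_le
  have h3 := hk.norm_y_le
  have h4 := norm_x_le (L := L) j
  have h5 := norm_y_le (L := L) k
  have h6 := hj.aNorm_le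
  have h7 := hk.aNorm_le
  have h8 := aNorm_le_natAbs (L := L) i
  have h9 : aNorm L i ≤ total L .a ps := by omega
  refine ⟨i, j, k, h, ⟨h9, by omega⟩, ⟨h6, by omega⟩, ⟨h7, by omega⟩, ?_, ?_⟩
  · obtain ⟨q, hq, hle⟩ := norm_toral_add_min_le_x hL i j k
    have h10 := Nat.mul_le_mul_left (L + 1) (show aNorm L i + aNorm L j + norm L (gen L .y ^ k)
      ≤ norm L (toral L i j k) + D by omega)
    refine le_or_le_of_min_le (q := q) (u := aNorm L j) ?_ (by omega) (by omega)
    simp only [mul_add] at hle h10 ⊢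
    omega
  · obtain ⟨q, hq, hle⟩ := norm_toral_add_min_le_y hL i j k
    have h10 := Nat.mul_le_mul_left (L + 1) (show aNorm L i + aNorm L k + norm L (gen L .x ^ j)
      ≤ norm L (toral L i j k) + D by omega)
    refine le_or_le_of_min_le (q := q) (u := aNorm L k) ?_ (by omega) (by omega)
    simp only [mul_add] at hle h10 ⊢
    omega

/-- By strict subadditivity, the pieces of one flavor in a nearly geodesic word cannot be divided
into two parts that are both long. -/
lemma min_total_le (hL : 5 ≤ L) {us vs : List (List Letter)} (hps : ∀ p ∈ us ++ vs, IsPiece L p)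
    {D : ℕ} (hD : wordLen L (us ++ vs).flatten ≤ norm L (wordVal L (us ++ vs).flatten) + D)
    {e : Gen} (he : e.IsToral) :
    min (total L e us) (total L e vs) ≤ (2 * L + 5) * (D + 6) := by
  obtain ⟨i, j, k, h, hi, hj, hk⟩ := exists_toral_of_pieces (L := L) (by omega)
    (fun p hp => hps p (List.mem_append_left vs hp))
  obtain ⟨i', j', k', h', hi', hj', hk'⟩ := exists_toral_of_pieces (L := L) (by omega)
    (fun p hp => hps p (List.mem_append_right us hp))
  rw [List.flatten_append, wordLen_append, wordVal_append, h, h', toral_mul, wordLen_flatten,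
    wordLen_flatten] at hD
  have h1 := norm_toral_le (L := L) (i + i') (j + j') (k + k')
  have h2 := (hj.add hj').norm_x_le
  have h3 := (hk.add hk').norm_y_le
  have h4 := norm_x_le (L := L) (j + j')
  have h5 := norm_y_le (L := L) (k + k')
  have h6 := aNorm_add_le (L := L) i i'
  have h7 := aNorm_le_natAbs (L := L) i
  have h8 := aNorm_le_natAbs (L := L) i'
  cases e
  · exact min_le_of_le_aNorm_add hL (n := i) (m := i') (by omega) (by omega) (by omega)
  · exact min_le_of_le_aNorm_add hL hj.aNorm_le hj'.aNorm_le (by omega)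
  · exact min_le_of_le_aNorm_add hL hk.aNorm_le hk'.aNorm_le (by omega)
  · exact he.elim
  · exact he.elim

/-- A list of weights such that no cut leaves weight more than `T` on both sides has an entry with
weight at most `T` on either side of it, unless the total weight is at most `T`. -/
lemma exists_dominant_of_split {α : Type*} (f : α → ℕ) (T : ℕ) (us vs : List α)
    (h : ∀ us' vs', us ++ vs = us' ++ vs' → min (us'.map f).sum (vs'.map f).sum ≤ T)
    (hus : (us.map f).sum ≤ T) :
    ((us ++ vs).map f).sum ≤ T ∨
      ∃ us' d vs', us ++ vs = us' ++ d :: vs' ∧ (us'.map f).sum ≤ T ∧ (vs'.map f).sum ≤ T := by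
  induction vs generalizing us with
  | nil => left; simpa using hus
  | cons d vs ih =>
    have heq : us ++ d :: vs = (us ++ [d]) ++ vs := by simp
    by_cases hd : ((us ++ [d]).map f).sum ≤ T
    · rw [heq] at h ⊢
      exact ih _ h hd
    · right
      have := h _ _ heq
      exact ⟨us, d, vs, rfl, hus, by omega⟩

/-! ### Positions of escapes in a word -/

/-- The subword of `w` from position `p.1` to position `p.2` is read along an escape of
flavor `e` if `w` is read from a point of `H`. -/
structure IsEscapeAt (L : ℕ) (w : List Letter) (p : ℕ × ℕ) (e : Gen) : Prop where
  lt : p.1 < p.2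
  le : p.2 ≤ w.length
  start_mem : wordVal L (w.take p.1) ∈ H L
  isEscapeWord : IsEscapeWord L ((w.take p.2).drop p.1)
  flavor_eq : wordFlavor ((w.take p.2).drop p.1) = e

lemma isPiece_flatten_mem {ps : List (List Letter)} (hps : ∀ p ∈ ps, IsPiece L p) :
    wordVal L ps.flatten ∈ H L := by
  induction ps with
  | nil => exact one_mem _
  | cons p ps ih =>
    rw [List.flatten_cons, wordVal_append]
    exact mul_mem (hps p List.mem_cons_self).val_mem
      (ih fun q hq => hps q (List.mem_cons_of_mem _ hq))

lemma drop_take_flatten (us : List (List Letter)) (d : List Letter) (vs : List (List Letter)) :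
    (((us ++ d :: vs).flatten).take (us.flatten.length + d.length)).drop us.flatten.length = d := by
  simp [List.take_append]

/-- The escapes among the subwords of a word cut into pieces are pieces. -/
lemma exists_split_of_isEscapeWord {ps : List (List Letter)} (hps : ∀ p ∈ ps, IsPiece L p)
    {p : ℕ × ℕ} (hlt : p.1 < p.2) (hle : p.2 ≤ ps.flatten.length)
    (hmem : wordVal L (ps.flatten.take p.1) ∈ H L)
    (hesc : IsEscapeWord L ((ps.flatten.take p.2).drop p.1)) :
    ∃ us d vs, ps = us ++ d :: vs ∧ p = (us.flatten.length, us.flatten.length + d.length) := by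
  induction ps generalizing p with
  | nil => simp at hle; omega
  | cons d ps ih =>
    obtain ⟨p₁, p₂⟩ := p
    simp only [List.flatten_cons] at *
    have hd := hps d List.mem_cons_self
    by_cases h1 : d.length ≤ p₁
    · have h2 : (d ++ ps.flatten).take p₁ = d ++ ps.flatten.take (p₁ - d.length) := by
        rw [List.take_append, List.take_of_length_le h1]
      have h3 : ((d ++ ps.flatten).take p₂).drop p₁ =
          (ps.flatten.take (p₂ - d.length)).drop (p₁ - d.length) := by
        rw [List.take_append, List.take_of_length_le (by omega), List.drop_append,
          List.drop_of_length_le h1, List.nil_append]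
      rw [h2, wordVal_append] at hmem
      rw [h3] at hesc
      obtain ⟨us, d', vs, rfl, hp⟩ := ih (fun q hq => hps q (List.mem_cons_of_mem _ hq))
        (p := (p₁ - d.length, p₂ - d.length)) (by simp; omega)
        (by simp at hle ⊢; omega) ((Subgroup.mul_mem_cancel_left _ hd.val_mem).1 hmem) hesc
      refine ⟨d :: us, d', vs, rfl, ?_⟩
      rw [Prod.mk.injEq] at hp ⊢
      simp only [List.flatten_cons, List.length_append]
      omega
    · rw [not_le] at h1
      obtain rfl : p₁ = 0 := by
        by_contra h0
        refine hd.take_notMem p₁ (by omega) h1 ?_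
        rwa [List.take_append_of_le_length h1.le] at hmem
      rw [List.drop_zero] at hesc
      refine ⟨[], d, ps, rfl, ?_⟩
      suffices p₂ = d.length by simp [this]
      rcases lt_trichotomy p₂ d.length with h | h | h
      · have h2 := hesc.val_mem
        rw [List.take_append_of_le_length h.le] at h2
        exact absurd h2 (hd.take_notMem p₂ hlt h)
      · exact h
      · refine absurd hd.val_mem ?_
        have h2 := hesc.take_notMem d.length h1 (by
          rw [List.length_take]; exact lt_min h (by simp at hle ⊢; omega))
        rwa [List.take_take, min_eq_left h.le, List.take_left] at h2

lemma IsEscapeAt.exists_split {ps : List (List Letter)} (hps : ∀ p ∈ ps, IsPiece L p)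
    {p : ℕ × ℕ} {e : Gen} (h : IsEscapeAt L ps.flatten p e) :
    ∃ us d vs, ps = us ++ d :: vs ∧ p = (us.flatten.length, us.flatten.length + d.length) ∧
      (ps.flatten.take p.2).drop p.1 = d ∧ wordFlavor d = e := by
  obtain ⟨us, d, vs, rfl, rfl⟩ := exists_split_of_isEscapeWord hps h.lt h.le h.start_mem
    h.isEscapeWord
  have h1 := h.flavor_eq
  simp only [drop_take_flatten] at h1
  exact ⟨us, d, vs, rfl, rfl, drop_take_flatten us d vs, h1⟩

lemma IsEscapeAt.wordLen_le {ps : List (List Letter)} (hps : ∀ p ∈ ps, IsPiece L p)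
    {p : ℕ × ℕ} {e : Gen} (h : IsEscapeAt L ps.flatten p e) :
    wordLen L ((ps.flatten.take p.2).drop p.1) ≤ total L e ps := by
  obtain ⟨us, d, vs, hsplit, -, hd, rfl⟩ := h.exists_split hps
  rw [hd]
  exact wordLen_le_total (by simp [hsplit])

/-- In a nearly geodesic word, all but one of the escapes of a given flavor are short. -/
lemma exists_dominant_escape (hL : 5 ≤ L) {ps : List (List Letter)}
    (hps : ∀ p ∈ ps, IsPiece L p) {D : ℕ}
    (hD : wordLen L ps.flatten ≤ norm L (wordVal L ps.flatten) + D) {e : Gen} (he : e.IsToral) :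
    total L e ps ≤ 3 * ((2 * L + 5) * (D + 6)) ∨
      ∃ p, IsEscapeAt L ps.flatten p e ∧
        total L e ps ≤ wordLen L ((ps.flatten.take p.2).drop p.1) + 3 * ((2 * L + 5) * (D + 6)) ∧
        ∀ q, IsEscapeAt L ps.flatten q e → q = p ∨
          wordLen L ((ps.flatten.take q.2).drop q.1) ≤ 3 * ((2 * L + 5) * (D + 6)) := by
  classical
  have hT : L ≤ (2 * L + 5) * (D + 6) := by nlinarith
  set T := (2 * L + 5) * (D + 6)
  rcases exists_dominant_of_split (fun p => if wordFlavor p = e then wordLen L p else 0) T [] ps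
    (fun us vs h => by
      rw [List.nil_append] at h
      subst h
      exact min_total_le hL hps hD he) (by simp) with h | ⟨us, d, vs, h, hus, hvs⟩
  · left
    change total L e ps ≤ T at h
    omega
  rw [List.nil_append] at h
  change total L e us ≤ T at hus
  change total L e vs ≤ T at hvs
  have htot : total L e ps =
      total L e us + ((if wordFlavor d = e then wordLen L d else 0) + total L e vs) := by
    rw [h, total_append, total_cons]
  by_cases hfl : wordFlavor d = e
  swap
  · left; rw [if_neg hfl] at htot; omega
  rw [if_pos hfl] at htot
  rcases hps d (by simp [h]) with ⟨l, rfl, -⟩ | hd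
  · left
    have : l.1.len L ≤ L + 5 := by rcases l with ⟨_ | _ | _ | _ | _, _⟩ <;> simp [Gen.len]
    have hlen : wordLen L [l] = l.1.len L := by simp
    have hT' : L + 5 ≤ T := by simp only [T]; nlinarith
    omega
  right
  have hsub := drop_take_flatten us d vs
  rw [← h] at hsub
  have hd0 : 0 < d.length := List.length_pos_iff.2 hd.ne_nil
  refine ⟨(us.flatten.length, us.flatten.length + d.length),
    ⟨by simpa using hd0, by simp [h], ?_, by simpa only [hsub] using hd,
      by simpa only [hsub] using hfl⟩, by simp only [hsub]; omega, ?_⟩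
  · have : ps.flatten.take us.flatten.length = us.flatten := by
      rw [h, List.flatten_append, List.take_left]
    simp only [this]
    exact isPiece_flatten_mem fun p hp => hps p (by simp [h, hp])
  · intro q hq
    obtain ⟨us', d', vs', h', rfl, hsub', hfl'⟩ := hq.exists_split hps
    rw [hsub']
    rw [h] at h'
    rcases List.append_eq_append_iff.1 h' with ⟨as, rfl, h2⟩ | ⟨as, rfl, h2⟩
    · rcases as with _ | ⟨b, as⟩
      · left
        rw [List.nil_append, List.cons.injEq] at h2
        simp [h2.1]
      · right
        rw [List.cons_append, List.cons.injEq] at h2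
        have := wordLen_le_total (L := L) (p := d') (ps := vs) (by simp [h2.2])
        rw [hfl'] at this
        omega
    · rcases as with _ | ⟨b, as⟩
      · left
        rw [List.nil_append, List.cons.injEq] at h2
        simp [h2.1]
      · right
        rw [List.cons_append, List.cons.injEq] at h2
        have := wordLen_le_total (L := L) (p := d') (ps := us' ++ b :: as) (by simp [h2.1])
        rw [hfl'] at this
        omega

/-! ### Escapes and biLipschitz paths -/

namespace EdgePath

lemma vertex_zero (γ : EdgePath L) : γ.vertex 0 = γ.start := by simp [vertex]

lemma finish_eq (γ : EdgePath L) : γ.finish = γ.start * wordVal L γ.word := by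
  simp [finish, vertex]

lemma start_inv_mul_finish (γ : EdgePath L) : γ.start⁻¹ * γ.finish = wordVal L γ.word := by
  rw [finish_eq, inv_mul_cancel_left]

lemma isEscape_iff (γ : EdgePath L) :
    γ.IsEscape ↔ γ.start ∈ H L ∧ IsEscapeWord L γ.word := by
  constructor
  · intro h
    have hmul : ∀ i, γ.vertex i ∈ H L ↔ wordVal L (γ.word.take i) ∈ H L := fun i =>
      Subgroup.mul_mem_cancel_left _ h.start_mem
    refine ⟨h.start_mem, h.nontrivial, ?_, fun i h0 hi => ?_, fun l hl ht => ?_⟩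
    · have := h.finish_mem
      rwa [finish_eq, Subgroup.mul_mem_cancel_left _ h.start_mem] at this
    · rw [← hmul]
      exact h.vertex_notMem i h0 hi
    · have h0 : 0 < γ.word.length := List.length_pos_iff.2 h.nontrivial
      refine h.edge_notMem ⟨0, h0⟩ ⟨?_, ?_⟩
      · simpa [vertex_zero] using h.start_mem
      · rw [List.head?_eq_getElem?, List.getElem?_eq_getElem h0] at hl
        simp only [Option.mem_def, Option.some.injEq] at hl
        simpa [hl] using ht
  · rintro ⟨hs, h⟩
    have hmul : ∀ i, γ.vertex i ∈ H L ↔ wordVal L (γ.word.take i) ∈ H L := fun i =>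
      Subgroup.mul_mem_cancel_left _ hs
    refine ⟨h.ne_nil, hs, ?_, fun i h0 hi => ?_, fun i hi => ?_⟩
    · rw [finish_eq]; exact mul_mem hs h.val_mem
    · rw [hmul]; exact h.take_notMem i h0 hi
    · obtain ⟨i, hi'⟩ := i
      rcases Nat.eq_zero_or_pos i with rfl | h0
      · refine h.head_notToral γ.word[0] ?_ hi.2
        rw [List.head?_eq_getElem?, List.getElem?_eq_getElem hi']
        rfl
      · exact h.take_notMem i h0 hi' ((hmul i).1 hi.1)

lemma subpath_isEscape_iff (γ : EdgePath L) (hγ : γ.start ∈ H L) (p : ℕ × ℕ) (h1 : p.1 < p.2)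
    (h2 : p.2 ≤ γ.word.length) :
    (γ.subpath p).IsEscape ↔
      IsEscapeAt L γ.word p (wordFlavor ((γ.word.take p.2).drop p.1)) := by
  have hmul : γ.vertex p.1 ∈ H L ↔ wordVal L (γ.word.take p.1) ∈ H L :=
    Subgroup.mul_mem_cancel_left _ hγ
  rw [isEscape_iff]
  exact ⟨fun h => ⟨h1, h2, hmul.1 h.1, h.2, rfl⟩, fun h => ⟨hmul.2 h.start_mem, h.isEscapeWord⟩⟩

lemma isEscapeOfFlavor_of_isEscapeAt (γ : EdgePath L) (hγ : γ.start ∈ H L) {p : ℕ × ℕ} {e : Gen}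
    (h : IsEscapeAt L γ.word p e) : (γ.subpath p).IsEscapeOfFlavor e := by
  have h' := h.flavor_eq
  subst h'
  refine ⟨(γ.subpath_isEscape_iff hγ p h.lt h.le).2 h, ?_⟩
  obtain ⟨e, b, v, n, he, hw, hv, hval⟩ := h.isEscapeWord.eq_conj
  refine ⟨n, ?_⟩
  rw [start_inv_mul_finish]
  change _ = wordVal L ((γ.word.take p.2).drop p.1)
  rw [hval, hw]
  rfl

/-- The points of the path at its first and last parameter are its endpoints. -/
lemma point_dist_le (γ : EdgePath L) (hn : 0 < γ.word.length) :
    pointDist L (γ.point ⟨0, hn⟩ ⟨0, le_rfl, Nat.cast_nonneg _⟩)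
      (γ.point ⟨γ.word.length - 1, by omega⟩ ⟨_, Nat.cast_nonneg _, le_rfl⟩) ≤
        norm L (wordVal L γ.word) := by
  have hpd : ∀ p q : Point L, pointDist L p q ≤ distThroughEnds L p q := fun p q => by
    unfold pointDist
    split
    · exact min_le_right _ _
    · exact le_rfl
  refine (hpd _ _).trans ?_
  -- a point at distance `0` from an end of its edge is that vertex
  have hdist : ∀ p q : Point L, ∀ g h : G L,
      (p.offset = 0 ∧ p.base = g ∨
        p.offset = p.label.len L ∧ p.base * gen L p.label = g) →
      (q.offset = 0 ∧ q.base = h ∨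
        q.offset = q.label.len L ∧ q.base * gen L q.label = h) →
      distThroughEnds L p q ≤ vertexDist L g h := by
    rintro p q g h (⟨hp, rfl⟩ | ⟨hp, rfl⟩) (⟨hq, rfl⟩ | ⟨hq, rfl⟩) <;>
      unfold distThroughEnds <;> rw [hp, hq]
    · exact (min_le_left _ _).trans ((min_le_left _ _).trans (by simp))
    · exact (min_le_left _ _).trans ((min_le_right _ _).trans (by simp))
    · exact (min_le_right _ _).trans ((min_le_left _ _).trans (by simp))
    · exact (min_le_right _ _).trans ((min_le_right _ _).trans (by simp))
  have hstep : ∀ i : Fin γ.word.length,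
      γ.vertex (i + 1) = γ.vertex i * letterVal L (γ.word.get i) := fun i => by
    rw [vertex, vertex, List.take_add_one, List.getElem?_eq_getElem i.2, wordVal_append, mul_assoc]
    simp
  have hval : (norm L (wordVal L γ.word) : ℝ) = vertexDist L (γ.vertex 0) γ.finish := by
    rw [vertexDist, vertex_zero, start_inv_mul_finish]
  rw [hval]
  apply hdist
  · unfold point
    split
    · exact Or.inl ⟨rfl, rfl⟩
    · next hb =>
      refine Or.inr ⟨by simp [edgeLen], ?_⟩
      change γ.vertex (0 + 1) * gen L (γ.word.get ⟨0, hn⟩).1 = γ.vertex 0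
      rw [hstep ⟨0, hn⟩, letterVal, if_neg hb, inv_mul_cancel_right]
  · have hlast : γ.word.length - 1 + 1 = γ.word.length := by omega
    unfold point finish
    split
    · next hb =>
      refine Or.inr ⟨by simp [edgeLen], ?_⟩
      have := hstep ⟨γ.word.length - 1, by omega⟩
      rw [letterVal, if_pos hb] at this
      simp only [hlast] at this
      exact this.symm
    · exact Or.inl ⟨by simp, by simp [hlast]⟩

/-- The only consequence of the biLipschitz condition that matters: the whole path is not much
longer than the distance between its endpoints. -/
lemma IsBiLipschitz.len_le {K : ℝ} (hK : 0 < K) {γ : EdgePath L} (h : γ.IsBiLipschitz K) :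
    (γ.len : ℝ) ≤ K * norm L (wordVal L γ.word) := by
  rcases Nat.eq_zero_or_pos γ.word.length with h0 | hn
  · have : γ.len = 0 := by simp [len, List.length_eq_zero_iff.1 h0]
    rw [this, Nat.cast_zero]
    positivity
  have h1 := (h ⟨0, hn⟩ ⟨γ.word.length - 1, by omega⟩ ⟨0, le_rfl, Nat.cast_nonneg _⟩
    ⟨_, Nat.cast_nonneg _, le_rfl⟩).1.trans (γ.point_dist_le hn)
  have h2 : (γ.len : ℝ) = wordLen L (γ.word.take (γ.word.length - 1)) +
      γ.edgeLen ⟨γ.word.length - 1, by omega⟩ := by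
    rw [len, edgeLen, ← Nat.cast_add]
    congr 1
    conv_lhs => rw [← List.take_length (l := γ.word), show γ.word.length = γ.word.length - 1 + 1
      by omega, List.take_add_one, wordLen_append]
    simp [List.getElem?_eq_getElem (show γ.word.length - 1 < γ.word.length by omega)]
  have h3 : |γ.param ⟨0, hn⟩ 0 - γ.param ⟨γ.word.length - 1, by omega⟩
      (γ.edgeLen ⟨γ.word.length - 1, by omega⟩)| = γ.len := by
    rw [h2, abs_sub_comm]
    simp only [param, List.take_zero, wordLen_nil]
    rw [abs_of_nonneg] <;> norm_num
    positivity
  rw [h3, inv_mul_le_iff₀ hK] at h1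
  exact h1

lemma mem_longEscapes_iff (γ : EdgePath L) (hγ : γ.start ∈ H L) (c : ℝ) (p : ℕ × ℕ) :
    p ∈ γ.longEscapes c ↔
      (∃ e, Gen.IsToral e ∧ IsEscapeAt L γ.word p e) ∧ c * γ.len ≤ (γ.subpath p).len := by
  constructor
  · rintro ⟨h1, h2, h3, h4⟩
    exact ⟨⟨_, wordFlavor_isToral _, (γ.subpath_isEscape_iff hγ p h1 h2).1 h3⟩, h4⟩
  · rintro ⟨⟨e, -, h⟩, h4⟩
    exact ⟨h.lt, h.le, (γ.isEscapeOfFlavor_of_isEscapeAt hγ h).1, h4⟩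

/-- Either the pieces of flavor `e`, of total length `E`, contain exactly one long escape, which
has nearly all of their length, or they contain none and `E` is small. -/
def HasAtMostOneLong (γ : EdgePath L) (c δ : ℝ) (e : Gen) (E : ℝ) : Prop :=
  (∃ p, IsEscapeAt L γ.word p e ∧ c * γ.len ≤ (γ.subpath p).len ∧ E ≤ (γ.subpath p).len + δ ∧
      ∀ q, IsEscapeAt L γ.word q e → c * γ.len ≤ (γ.subpath q).len → q = p) ∨
    (E ≤ c * γ.len + δ ∧ ∀ q, IsEscapeAt L γ.word q e → (γ.subpath q).len < c * γ.len)

lemma hasOneLongEscape_of {γ : EdgePath L} (hγ : γ.start ∈ H L) {c : ℝ} {p : ℕ × ℕ} {e : Gen}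
    (he : e.IsToral) (hp : IsEscapeAt L γ.word p e) (hlong : c * γ.len ≤ (γ.subpath p).len)
    (huniq : ∀ q, IsEscapeAt L γ.word q e → c * γ.len ≤ (γ.subpath q).len → q = p)
    (hshort : ∀ e', e'.IsToral → e' ≠ e → ∀ q, IsEscapeAt L γ.word q e' →
      ((γ.subpath q).len : ℝ) < c * γ.len) :
    γ.HasOneLongEscape c p := by
  ext q
  rw [mem_longEscapes_iff γ hγ, Set.mem_singleton_iff]
  constructor
  · rintro ⟨⟨e', he', hq⟩, hl⟩
    by_cases h : e' = e
    · subst h; exact huniq q hq hl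
    · exact absurd hl (not_le.2 (hshort e' he' h q hq))
  · rintro rfl
    exact ⟨⟨e, he, hp⟩, hlong⟩

lemma hasAtMostOneLong (hL : 5 ≤ L) {γ : EdgePath L} {ps : List (List Letter)}
    (hw : ps.flatten = γ.word) (hps : ∀ p ∈ ps, IsPiece L p) {D : ℕ}
    (hD : wordLen L ps.flatten ≤ norm L (wordVal L ps.flatten) + D) {c δ : ℝ}
    (hT : ((3 * ((2 * L + 5) * (D + 6)) : ℕ) : ℝ) ≤ δ) (hδ : δ < c * γ.len) {e : Gen}
    (he : e.IsToral) : γ.HasAtMostOneLong c δ e (total L e ps) := by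
  have h := exists_dominant_escape hL hps hD he
  have hle := fun (q : ℕ × ℕ) (hq : IsEscapeAt L ps.flatten q e) => hq.wordLen_le hps
  rw [hw] at h hle
  rcases h with h | ⟨p, hp, hp1, hp2⟩
  · have h' : (total L e ps : ℝ) ≤ δ := le_trans (by exact_mod_cast h) hT
    refine Or.inr ⟨by linarith [(Nat.cast_nonneg _).trans hT], fun q hq => ?_⟩
    have : ((γ.subpath q).len : ℝ) ≤ total L e ps := by exact_mod_cast hle q hq
    linarith
  · have h1 : (total L e ps : ℝ) ≤ (γ.subpath p).len + δ := by
      have : (total L e ps : ℝ) ≤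
          (γ.subpath p).len + ((3 * ((2 * L + 5) * (D + 6)) : ℕ) : ℝ) := by exact_mod_cast hp1
      linarith
    have h2 : ∀ q, IsEscapeAt L γ.word q e → q = p ∨ ((γ.subpath q).len : ℝ) ≤ δ := fun q hq =>
      (hp2 q hq).imp_right fun h => le_trans (by exact_mod_cast h) hT
    by_cases hlong : c * γ.len ≤ (γ.subpath p).len
    · exact Or.inl ⟨p, hp, hlong, h1, fun q hq hl => (h2 q hq).resolve_right fun h => by linarith⟩
    · refine Or.inr ⟨by linarith, fun q hq => ?_⟩
      rcases h2 q hq with rfl | h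
      · exact not_le.1 hlong
      · linarith

/-- The conclusion of the theorem, from the estimates on the lengths `A`, `X`, `Y` of the pieces of
the three flavors. -/
lemma longEscapes_dichotomy (hL : 5 ≤ L) {R' : ℝ} (hR' : 1 < R') {γ : EdgePath L}
    (hγ : γ.start ∈ H L) {i j k : ℤ} (hval : wordVal L γ.word = toral L i j k) {c δ : ℝ}
    (hc : c = 1 / (10 * R')) (hδ : 10 * δ = c * γ.len) (hδ4 : 4 ≤ δ) {A X Y : ℕ}
    (hlen : γ.len = A + X + Y) (hi : aNorm L i ≤ A ∧ (A : ℝ) ≤ aNorm L i + δ)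
    (hj : aNorm L j ≤ X ∧ (X : ℝ) ≤ aNorm L j + δ) (hk : aNorm L k ≤ Y ∧ (Y : ℝ) ≤ aNorm L k + δ)
    (hAX : (A : ℝ) ≤ δ ∨ (X : ℝ) ≤ δ) (hAY : (A : ℝ) ≤ δ ∨ (Y : ℝ) ≤ δ)
    (hleA : ∀ q, IsEscapeAt L γ.word q .a → (γ.subpath q).len ≤ A)
    (hleX : ∀ q, IsEscapeAt L γ.word q .x → (γ.subpath q).len ≤ X)
    (hleY : ∀ q, IsEscapeAt L γ.word q .y → (γ.subpath q).len ≤ Y)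
    (ha : γ.HasAtMostOneLong c δ .a A) (hx : γ.HasAtMostOneLong c δ .x X)
    (hy : γ.HasAtMostOneLong c δ .y Y) :
    ((∃ ε, γ.HasOneLongEscape c ε ∧
          (R' - 1) / R' * γ.len ≤ (γ.subpath ε).len) ∨
        (∃ ε₀ ε₁, γ.HasTwoLongEscapes c ε₀ ε₁ ∧
          (R' - 1) / R' * γ.len ≤ (γ.subpath ε₀).len + (γ.subpath ε₁).len)) ∧
      (γ.DiffersByPowerOf .x →
        ∃ ε, γ.HasOneLongEscape c ε ∧ (γ.subpath ε).IsEscapeOfFlavor .x) ∧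
      (γ.DiffersByPowerOf .y →
        ∃ ε, γ.HasOneLongEscape c ε ∧ (γ.subpath ε).IsEscapeOfFlavor .y) ∧
      (γ.DiffersByPowerOf .a →
        (∃ ε, γ.HasOneLongEscape c ε ∧ (γ.subpath ε).IsEscapeOfFlavor .a) ∨
        (∃ ε₀ ε₁, γ.HasTwoLongEscapes c ε₀ ε₁)) := by
  have hlenR : (γ.len : ℝ) = A + X + Y := by exact_mod_cast hlen
  have hmain : (R' - 1) / R' * γ.len = γ.len - 10 * (c * γ.len) := by
    rw [hc]; field_simp
  have hbig : 10 * (c * γ.len) ≤ γ.len := by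
    have h0 : (0 : ℝ) ≤ γ.len := Nat.cast_nonneg _
    have : 10 * c ≤ 1 := by
      rw [hc, ← mul_div_assoc, div_le_one (by linarith)]; linarith
    nlinarith
  rw [hmain]
  set B := c * (γ.len : ℝ) with hB
  -- the exponents when the endpoints differ by a power of `x`, `y` or `a`
  have hpowx : γ.DiffersByPowerOf .x → aNorm L k ≤ aNorm L i ∧ aNorm L i ≤ 2 * aNorm L k + 4 := by
    rintro ⟨n, hn⟩
    rw [start_inv_mul_finish, hval] at hn
    have h := (toral_inj ((toral_x n).trans hn)).1
    have h1 : aNorm L i = aNorm L (L * k) := by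
      rw [← aNorm_neg]; congr 1; linarith
    rw [h1]
    exact ⟨aNorm_le_aNorm_mul hL k, by simpa using aNorm_add_mul_le (L := L) 0 k⟩
  have hpowy : γ.DiffersByPowerOf .y → aNorm L j ≤ aNorm L i ∧ aNorm L i ≤ 2 * aNorm L j + 4 := by
    rintro ⟨n, hn⟩
    rw [start_inv_mul_finish, hval] at hn
    obtain ⟨h, h'⟩ := toral_inj ((toral_y n).trans hn)
    have h1 : aNorm L i = aNorm L (L * j) := by
      rw [← aNorm_neg]; congr 1
      rw [show j = k - n by linarith]
      linarith
    rw [h1]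
    exact ⟨aNorm_le_aNorm_mul hL j, by simpa using aNorm_add_mul_le (L := L) 0 j⟩
  have hpowa : γ.DiffersByPowerOf .a → j = k := by
    rintro ⟨n, hn⟩
    rw [start_inv_mul_finish, hval] at hn
    have h := (toral_inj ((toral_a n).trans hn)).2
    linarith
  have hiR : (aNorm L i : ℝ) ≤ A := by exact_mod_cast hi.1
  have hjR : (aNorm L j : ℝ) ≤ X := by exact_mod_cast hj.1
  have hkR : (aNorm L k : ℝ) ≤ Y := by exact_mod_cast hk.1
  have hleA' : ∀ q, IsEscapeAt L γ.word q .a → ((γ.subpath q).len : ℝ) ≤ A := fun q hq => by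
    exact_mod_cast hleA q hq
  have hleX' : ∀ q, IsEscapeAt L γ.word q .x → ((γ.subpath q).len : ℝ) ≤ X := fun q hq => by
    exact_mod_cast hleX q hq
  have hleY' : ∀ q, IsEscapeAt L γ.word q .y → ((γ.subpath q).len : ℝ) ≤ Y := fun q hq => by
    exact_mod_cast hleY q hq
  by_cases hA : (A : ℝ) ≤ δ
  · rcases hx with ⟨p, hp, hpl, hpX, hpu⟩ | ⟨hxX, hxs⟩ <;>
      rcases hy with ⟨q, hq, hql, hqY, hqu⟩ | ⟨hyY, hys⟩
    · have htwo : γ.HasTwoLongEscapes c p q := by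
        refine ⟨?_, ?_, γ.isEscapeOfFlavor_of_isEscapeAt hγ hp,
          γ.isEscapeOfFlavor_of_isEscapeAt hγ hq⟩
        · ext r
          rw [mem_longEscapes_iff γ hγ]
          constructor
          · rintro ⟨⟨e, he, hr⟩, hl⟩
            cases e
            · have := hleA' r hr
              linarith
            · exact Or.inl (hpu r hr hl)
            · exact Or.inr (hqu r hr hl)
            · exact he.elim
            · exact he.elim
          · rintro (rfl | rfl)
            · exact ⟨⟨.x, trivial, hp⟩, hpl⟩
            · exact ⟨⟨.y, trivial, hq⟩, hql⟩
        · rintro rfl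
          have := hp.flavor_eq.symm.trans hq.flavor_eq
          cases this
      refine ⟨Or.inr ⟨p, q, htwo, by linarith⟩, fun h => ?_, fun h => ?_,
        fun _ => Or.inr ⟨p, q, htwo⟩⟩
      · have h1 : (aNorm L k : ℝ) ≤ aNorm L i := by exact_mod_cast (hpowx h).1
        have := hleY' q hq
        linarith
      · have h1 : (aNorm L j : ℝ) ≤ aNorm L i := by exact_mod_cast (hpowy h).1
        have := hleX' p hp
        linarith
    · have hone : γ.HasOneLongEscape c p := by
        refine hasOneLongEscape_of hγ (e := .x) trivial hp hpl hpu fun e he hne r hr => ?_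
        cases e
        · have := hleA' r hr
          linarith
        · exact absurd rfl hne
        · exact hys r hr
        · exact he.elim
        · exact he.elim
      refine ⟨Or.inl ⟨p, hone, by linarith⟩,
        fun _ => ⟨p, hone, γ.isEscapeOfFlavor_of_isEscapeAt hγ hp⟩, fun h => ?_, fun h => ?_⟩
      · have h1 : (aNorm L j : ℝ) ≤ aNorm L i := by exact_mod_cast (hpowy h).1
        have := hleX' p hp
        linarith
      · rw [hpowa h] at hj
        linarith
    · have hone : γ.HasOneLongEscape c q := by
        refine hasOneLongEscape_of hγ (e := .y) trivial hq hql hqu fun e he hne r hr => ?_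
        cases e
        · have := hleA' r hr
          linarith
        · exact hxs r hr
        · exact absurd rfl hne
        · exact he.elim
        · exact he.elim
      refine ⟨Or.inl ⟨q, hone, by linarith⟩, fun h => ?_,
        fun _ => ⟨q, hone, γ.isEscapeOfFlavor_of_isEscapeAt hγ hq⟩, fun h => ?_⟩
      · have h1 : (aNorm L k : ℝ) ≤ aNorm L i := by exact_mod_cast (hpowx h).1
        have := hleY' q hq
        linarith
      · rw [← hpowa h] at hk
        linarith
    · linarith
  · have hX := hAX.resolve_left hA
    have hY := hAY.resolve_left hA
    rcases ha with ⟨p, hp, hpl, hpA, hpu⟩ | ⟨haA, -⟩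
    · have hone : γ.HasOneLongEscape c p := by
        refine hasOneLongEscape_of hγ (e := .a) trivial hp hpl hpu fun e he hne r hr => ?_
        cases e
        · exact absurd rfl hne
        · have := hleX' r hr
          linarith
        · have := hleY' r hr
          linarith
        · exact he.elim
        · exact he.elim
      refine ⟨Or.inl ⟨p, hone, by linarith⟩, fun h => ?_, fun h => ?_,
        fun _ => Or.inl ⟨p, hone, γ.isEscapeOfFlavor_of_isEscapeAt hγ hp⟩⟩
      · have h1 : (aNorm L i : ℝ) ≤ 2 * aNorm L k + 4 := by exact_mod_cast (hpowx h).2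
        linarith
      · have h1 : (aNorm L i : ℝ) ≤ 2 * aNorm L j + 4 := by exact_mod_cast (hpowy h).2
        linarith
    · linarith

end EdgePath

end Snowflake

/-! ### The choice of constants -/

theorem theorem6p11 (L : ℕ) (hLeven : Even L) (hL : 6 ≤ L) (R' : ℝ) (hR' : 1 < R') :
    ∃ J' K c : ℝ, 1 < J' ∧ 1 < K ∧ K < 2 ∧ 0 < c ∧
      ∀ γ : Snowflake.EdgePath L,
        γ.IsBiLipschitz K → γ.start ∈ Snowflake.H L → γ.finish ∈ Snowflake.H L →
        (γ.len : ℝ) ≤ J' ∨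
          (((∃ ε, γ.HasOneLongEscape c ε ∧
                (R' - 1) / R' * γ.len ≤ (γ.subpath ε).len) ∨
              (∃ ε₀ ε₁, γ.HasTwoLongEscapes c ε₀ ε₁ ∧
                (R' - 1) / R' * γ.len ≤ (γ.subpath ε₀).len + (γ.subpath ε₁).len)) ∧
            (γ.DiffersByPowerOf .x →
              ∃ ε, γ.HasOneLongEscape c ε ∧ (γ.subpath ε).IsEscapeOfFlavor .x) ∧
            (γ.DiffersByPowerOf .y →
              ∃ ε, γ.HasOneLongEscape c ε ∧ (γ.subpath ε).IsEscapeOfFlavor .y) ∧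
            (γ.DiffersByPowerOf .a →
              (∃ ε, γ.HasOneLongEscape c ε ∧ (γ.subpath ε).IsEscapeOfFlavor .a) ∨
              (∃ ε₀ ε₁, γ.HasTwoLongEscapes c ε₀ ε₁))) := by
  have hL5 : 5 ≤ L := by omega
  -- Each error term is at most `M * (D + 6)`, where `D` is the excess of the length of the path
  -- over the distance of its endpoints. The constants make this at most `c * |γ| / 10`: half of
  -- it bounds `M * D` (choice of `K`), half of it bounds `6 * M` (choice of `J'`).
  have hLR : (6 : ℝ) ≤ L := by exact_mod_cast hL
  obtain ⟨M, hM⟩ : ∃ M : ℝ, M = 3 * (2 * L + 5) := ⟨_, rfl⟩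
  obtain ⟨c, hc⟩ : ∃ c : ℝ, c = 1 / (10 * R') := ⟨_, rfl⟩
  have hM1 : 1 < M := by linarith
  have hc0 : 0 < c := by rw [hc]; positivity
  have hc1 : c < 1 := by rw [hc, div_lt_one (by linarith)]; linarith
  refine ⟨120 * M / c, 1 + c / (20 * M), c, ?_, ?_, ?_, hc0, fun γ hγ hs hf => ?_⟩
  · rw [lt_div_iff₀ hc0]; linarith
  · have : 0 < c / (20 * M) := by positivity
    linarith
  · have : c / (20 * M) < 1 := by rw [div_lt_one (by linarith)]; linarith
    linarith
  refine or_iff_not_imp_left.2 fun hJ => ?_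
  rw [not_le, div_lt_iff₀ hc0] at hJ
  have hmem : Snowflake.wordVal L γ.word ∈ Snowflake.H L := by
    rw [← γ.start_inv_mul_finish]
    exact mul_mem (inv_mem hs) hf
  obtain ⟨ps, hw, hps⟩ := Snowflake.exists_pieces _ hmem
  have hbl := hγ.len_le (by positivity)
  have hnorm := Snowflake.norm_wordVal_le (L := L) γ.word
  obtain ⟨D, hDeq⟩ := Nat.exists_eq_add_of_le hnorm
  have hD : Snowflake.wordLen L ps.flatten ≤
      Snowflake.norm L (Snowflake.wordVal L ps.flatten) + D := by rw [hw]; exact hDeq.le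
  have hDle : (D : ℝ) ≤ c / (20 * M) * γ.len := by
    have h1 : (γ.len : ℝ) = Snowflake.norm L (Snowflake.wordVal L γ.word) + D := by
      exact_mod_cast hDeq
    have h2 : (Snowflake.norm L (Snowflake.wordVal L γ.word) : ℝ) ≤ γ.len := by
      exact_mod_cast hnorm
    have h3 := mul_le_mul_of_nonneg_left h2 (show 0 ≤ c / (20 * M) by positivity)
    linarith
  have hMD : M * (D + 6) ≤ c * γ.len / 10 := by
    have h1 := mul_le_mul_of_nonneg_left hDle (show 0 ≤ M by linarith)
    have h2 : M * (c / (20 * M) * γ.len) = c * γ.len / 20 := by field_simp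
    linarith
  have hT : ((3 * ((2 * L + 5) * (D + 6)) : ℕ) : ℝ) ≤ c * γ.len / 10 := by
    refine le_trans (le_of_eq ?_) hMD
    rw [hM]; push_cast; ring
  have hT' : (((2 * L + 5) * (D + 6) : ℕ) : ℝ) ≤ c * γ.len / 10 :=
    le_trans (by exact_mod_cast (by omega)) hT
  have hD2 : ((D + 6 : ℕ) : ℝ) ≤ c * γ.len / 10 :=
    le_trans (by exact_mod_cast (Nat.le_mul_of_pos_left _ (by omega))) hT'
  push_cast at hD2
  have hD0 : (0 : ℝ) ≤ D := Nat.cast_nonneg D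
  have hδ : c * γ.len / 10 < c * γ.len := by linarith
  obtain ⟨i, j, k, hval, hi, hj, hk, hAX, hAY⟩ :=
    Snowflake.exists_toral_of_nearGeodesic hL5 hps hD
  have hle : ∀ e q, Snowflake.IsEscapeAt L γ.word q e →
      (γ.subpath q).len ≤ Snowflake.total L e ps := fun e q hq => by
    rw [← hw] at hq
    have := hq.wordLen_le hps
    rwa [hw] at this
  have hcast : ∀ u v : ℕ, u ≤ v + (D + 2) → (u : ℝ) ≤ v + c * γ.len / 10 := fun u v h => by
    have : (u : ℝ) ≤ v + (D + 2) := by exact_mod_cast h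
    linarith
  have hcast' : ∀ u : ℕ, u ≤ (2 * L + 5) * (D + 6) → (u : ℝ) ≤ c * γ.len / 10 := fun u h =>
    le_trans (by exact_mod_cast h) hT'
  rw [hw] at hval
  exact Snowflake.EdgePath.longEscapes_dichotomy hL5 hR' hs hval hc (by ring) (by linarith)
    (by rw [← Snowflake.wordLen_flatten, hw]; rfl)
    ⟨hi.1, hcast _ _ hi.2⟩ ⟨hj.1, hcast _ _ hj.2⟩ ⟨hk.1, hcast _ _ hk.2⟩
    (hAX.imp (hcast' _) (hcast' _)) (hAY.imp (hcast' _) (hcast' _)) (hle _) (hle _) (hle _)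
    (Snowflake.EdgePath.hasAtMostOneLong hL5 hw hps hD hT hδ trivial)
    (Snowflake.EdgePath.hasAtMostOneLong hL5 hw hps hD hT hδ trivial)
    (Snowflake.EdgePath.hasAtMostOneLong hL5 hw hps hD hT hδ trivial)
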